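/- Let $\mathbb X\subseteq\mathbb R^d$ carry the Euclidean metric and its Borel $\sigma$-algebra, let $Q$ be a probability distribution on $\mathbb X\times\{+1,-1\}$ with input marginal $Q_X$, and let $(X_1,Y_1),(X_2,Y_2),\dots$ be i.i.d. with law $Q$. Let $\{f_\theta:\mathbb X\to[-1,1]\mid\theta\in\Theta\}$ be a family of measurable functions, indexed by an arbitrary set $\Theta$, such that $\int (f_{\theta_1}-f_{\theta_2})^2\,dQ_X\neq 0$ whenever $\theta_1\ne\theta_2$, and which contains the regression function: there is $\theta^*\in\Theta$ with $f_{\theta^*}(x)=\mathbb E[Y\mid X=x]$ for $Q_X$-almost every $x$, where $(X,Y)\sim Q$. Let $m\ge 1$ and $0\le q\le m$ be integers and let $(k_n)$ be a sequence of non-negative integers. For every $n$ let $U_{i,j}$ ($1\le i\le n$, $1\le j\le m-1$) be i.i.d. uniform on $[-1,1]$, let $\pi$ be a uniformly distributed random permutation of $\{1,\dots,m\}$, and let $\sigma$ be a random permutation of $\{1,\dots,n\}$ of any distribution (for example a constant one); these may depend on $n$ in any way, and for each fixed $n$ the sample $(X_i,Y_i)_{i\le n}$, the array $(U_{i,j})$,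 $\pi$ and $\sigma$ are mutually independent. For $\theta\in\Theta$ put $Y_{i,0}(\theta)=Y_i$ and $Y_{i,j}(\theta)=\operatorname{sign}(f_\theta(X_i)+U_{i,j})$ for $1\le j\le m-1$ (with $\operatorname{sign}(0)=1$). Let $N_n(x)$ be the set of indices of the $k_n$ points among $X_1,\dots,X_n$ that are closest to $x$ (all indices if $k_n>n$), where equal distances are ordered by $\sigma$. For $0\le j\le m-1$ let $$f^{(j)}_{\theta,n}(x)=\frac1{k_n}\sum_{i\in N_n(x)}Y_{i,j}(\theta),\qquad Z^{(j)}_n(\theta)=\frac1n\sum_{i=1}^n\bigl(f_\theta(X_i)-f^{(j)}_{\theta,n}(X_i)\bigr)^2$$ (with $1/0:=0$). Let the rank of $\theta$ be $1$ plus the number of $j\in\{1,\dots,m-1\}$ such that $Z_n^{(j)}(\theta)<Z_n^{(0)}(\theta)$, or $Z_n^{(j)}(\theta)=Z_n^{(0)}(\theta)$ and $\pi(j)<\pi(m)$, and let $\Theta_n^{(2)}$ be the random set of all $\theta\in\Theta$ whose rank is at most $q$. Then, for every $n$, $\mathbb P(\theta^*\in\Theta_n^{(2)})=q/m$. Suppose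 moreover that $q<m$, that $k_n/n\to0$, that $k_n^2/n^{1+\delta}\to\infty$ for some $\delta>0$, and that $\mathbb P(\|X-X'\|\neq\|X-X''\|)=1$ for independent $X,X',X''\sim Q_X$. Then $(\Theta_n^{(2)})$ is strongly pointwise consistent: for every $\theta\in\Theta$ with $\theta\ne\theta^*$, $$\mathbb P\Bigl(\bigcap_{n=1}^\infty\bigcup_{l=n}^\infty\{\theta\in\Theta_l^{(2)}\}\Bigr)=0 .$$ -/

import Mathlib

open MeasureTheory ProbabilityTheory Filter
open scoped ENNReal Topology

namespace KnnRegion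

/-- The output space `{+1, -1}`, with the σ-algebra inherited from `ℝ`. -/
abbrev Label : Type := ({1, -1} : Set ℝ)

/-- The label-valued sign; the value at `0` is a convention. -/
noncomputable def sgn (t : ℝ) : Label :=
  if 0 ≤ t then ⟨1, by simp⟩ else ⟨-1, by simp⟩

/-- Permutations of a finite set carry the discrete σ-algebra. -/
instance permMeasurableSpace (n : ℕ) : MeasurableSpace (Equiv.Perm (Fin n)) := ⊤

section Model

variable {𝕏 : Type*} [MeasurableSpace 𝕏]

/-- `g` is (a version of) the regression function `x ↦ E[Y | X = x]` for `(X, Y) ∼ Q`. -/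
def IsRegressionFunction (Q : Measure (𝕏 × Label)) (g : 𝕏 → ℝ) : Prop :=
  (fun p : 𝕏 × Label => g p.1) =ᵐ[Q]
    Q[fun p : 𝕏 × Label => (p.2 : ℝ) | MeasurableSpace.comap Prod.fst inferInstance]

/-- The squared `L²(Q_X)` distance `∫ (g - h)² dQ_X`, where `Q_X` is the input marginal of `Q`. -/
noncomputable def sqDistQ (Q : Measure (𝕏 × Label)) (g h : 𝕏 → ℝ) : ℝ :=
  ∫ x, (g x - h x) ^ 2 ∂Q.fst

variable {Ω : Type*} [MeasurableSpace Ω]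

/-- The observations `(X i, Y i)`, `i = 0, 1, 2, …`, are i.i.d. with law `Q`. -/
structure IsIIDSample (μ : Measure Ω) (Q : Measure (𝕏 × Label))
    (X : ℕ → Ω → 𝕏) (Y : ℕ → Ω → Label) : Prop where
  measurable_X : ∀ i, Measurable (X i)
  measurable_Y : ∀ i, Measurable (Y i)
  law : ∀ i, μ.map (fun ω => (X i ω, Y i ω)) = Q
  indep : iIndepFun (fun i ω => (X i ω, Y i ω)) μ

/-- The randomness generated by the algorithm with `m = r + 1` datasets. For every sample size `n`:
an array `U n i j` of i.i.d. uniform variables on `[-1, 1]`, a uniformly distributed permutation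
`π n` of the `m` datasets, and a permutation `σ n` of the sample indices (of any distribution, for
example constant or uniform) giving the priorities by which ties between distances are broken.
The first `n` observations, the array `U n`, `π n` and `σ n` are mutually independent.
Nothing is assumed about the joint law of the generated variables for different `n`: they may be
drawn afresh, or the array of size `n` may extend the earlier ones. -/
structure IsInitialization {r : ℕ} (μ : Measure Ω) (X : ℕ → Ω → 𝕏) (Y : ℕ → Ω → Label)
    (U : (n : ℕ) → Fin n → Fin r → Ω → ℝ) (π : ℕ → Ω → Equiv.Perm (Fin (r + 1)))
    (σ : (n : ℕ) → Ω → Equiv.Perm (Fin n)) : Prop where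
  measurable_U : ∀ n i j, Measurable (U n i j)
  measurable_π : ∀ n, Measurable (π n)
  measurable_σ : ∀ n, Measurable (σ n)
  uniform_U : ∀ n i j, pdf.IsUniform (U n i j) (Set.Icc (-1 : ℝ) 1) μ volume
  indep_U : ∀ n, iIndepFun (fun (p : Fin n × Fin r) ω => U n p.1 p.2 ω) μ
  uniform_π : ∀ n, μ.map (π n) = uniformOn Set.univ
  indep_sample : ∀ n, IndepFun (fun ω (i : Fin n) => (X i ω, Y i ω))
    (fun ω => ((fun (p : Fin n × Fin r) => U n p.1 p.2 ω), π n ω, σ n ω)) μ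
  indep_array : ∀ n, IndepFun (fun ω (p : Fin n × Fin r) => U n p.1 p.2 ω)
    (fun ω => (π n ω, σ n ω)) μ
  indep_perm : ∀ n, IndepFun (π n) (σ n) μ

end Model

section Procedure

variable {𝕏 : Type*} {n r : ℕ}

/-- The `j`-th alternative sample `(x_i, sgn (g (x_i) + u_{i,j}))`, `i = 1, …, n`, for the
candidate regression function `g`. -/
noncomputable def altSample (g : 𝕏 → ℝ) (D : Fin n → 𝕏 × Label) (u : Fin n → Fin r → ℝ)
    (j : Fin r) : Fin n → 𝕏 × Label :=
  fun i => ((D i).1, sgn (g (D i).1 + u i j))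

variable [PseudoMetricSpace 𝕏]

open Classical in
/-- The (indices of the) `k` nearest neighbours of `x` among `xs 0, …, xs (n - 1)`: those `i` that
have fewer than `k` predecessors when the indices are ordered by distance to `x`, equal distances
being ordered by the priorities `s`. -/
noncomputable def neighbors (k : ℕ) (s : Equiv.Perm (Fin n)) (xs : Fin n → 𝕏) (x : 𝕏) :
    Finset (Fin n) :=
  {i : Fin n | (Finset.card {l : Fin n | dist (xs l) x < dist (xs i) x ∨
    (dist (xs l) x = dist (xs i) x ∧ s l < s i)}) < k}

/-- The kNN regression estimate based on the dataset `D`. -/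
noncomputable def knnEstimate (k : ℕ) (s : Equiv.Perm (Fin n)) (D : Fin n → 𝕏 × Label) (x : 𝕏) :
    ℝ :=
  1 / (k : ℝ) * ∑ i ∈ neighbors k s (fun l => (D l).1) x, ((D i).2 : ℝ)

/-- The reference variable of the dataset `D`: the empirical squared distance of the candidate `g`
from the kNN estimate based on `D`. -/
noncomputable def refVar (k : ℕ) (s : Equiv.Perm (Fin n)) (g : 𝕏 → ℝ) (D : Fin n → 𝕏 × Label) :
    ℝ :=
  1 / (n : ℝ) * ∑ i, (g (D i).1 - knnEstimate k s D (D i).1) ^ 2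

open Classical in
/-- The rank of `z₀` among `z₀, z 0, …, z (r - 1)`: one plus the number of `z j` that precede `z₀`
in the order by value, ties being resolved by the permutation `p`. The original dataset has the tie
key `p (last)`, the alternative datasets have the other keys. -/
noncomputable def rank (p : Equiv.Perm (Fin (r + 1))) (z₀ : ℝ) (z : Fin r → ℝ) : ℕ :=
  1 + Finset.card {j : Fin r | z j < z₀ ∨ (z j = z₀ ∧ p j.castSucc < p (Fin.last r))}

/-- The kNN-based confidence region: all parameters `θ` for which the reference variable of the
original dataset `D` has rank at most `q` among those of `D` and its alternatives. -/
noncomputable def region {Θ : Type*} (f : Θ → 𝕏 → ℝ) (q k : ℕ) (s : Equiv.Perm (Fin n))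
    (p : Equiv.Perm (Fin (r + 1))) (D : Fin n → 𝕏 × Label) (u : Fin n → Fin r → ℝ) : Set Θ :=
  {θ | rank p (refVar k s (f θ) D) (fun j => refVar k s (f θ) (altSample (f θ) D u j)) ≤ q}

end Procedure

/-- The random region `Θ_n` built from the first `n` observations. -/
noncomputable def randomRegion {𝕏 Ω Θ : Type*} [PseudoMetricSpace 𝕏] {r : ℕ} (f : Θ → 𝕏 → ℝ)
    (q : ℕ) (k : ℕ → ℕ) (X : ℕ → Ω → 𝕏) (Y : ℕ → Ω → Label)
    (U : (n : ℕ) → Fin n → Fin r → Ω → ℝ) (π : ℕ → Ω → Equiv.Perm (Fin (r + 1)))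
    (σ : (n : ℕ) → Ω → Equiv.Perm (Fin n)) (n : ℕ) (ω : Ω) : Set Θ :=
  region f q (k n) (σ n ω) (π n ω) (fun i : Fin n => (X i ω, Y i ω)) (fun i j => U n i j ω)

end KnnRegion

/-! Coverage is exchangeability. A label with regression function `g` is distributed as `sgn (g x +
V)` with `V` uniform on `[-1, 1]` (`map_sgn_eq`), so at the true parameter the original sample may
be regarded as labelled by one more column of uniforms. All `r + 1` reference variables are then the
same function of the inputs, `σ` and their own column. Permuting the columns together with the tie
keys preserves `jointLaw`, so each dataset is equally likely to have fewer than `q` predecessors;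
exactly `q` datasets do, because the tie keys make the order strict. This gives `q / (r + 1)`
(`jointLaw_predCount_lt`).

Consistency is separation of reference variables. When the labels are generated by `g`, the residual
of the kNN estimate is a bias plus an averaged noise. The mean squared bias vanishes almost surely:
`g` is approximated in `L²` by a compactly supported continuous function, which varies little over
small neighbourhoods, and Stone's lemma bounds the cost of the approximation (`ae_tendsto_bias`).
Given the inputs, Hoeffding's inequality and a union bound control the noise by `2 n exp (-k t² /
2)`, which is summable because `k n ≥ √n` eventually; Borel–Cantelli applies. Hence the alternatives
for a wrong `θ`, and the original sample measured against the true parameter, eventually have small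
reference variables. By `le_refVar` the original sample cannot be close to both candidates, since
their empirical distance converges to a positive limit. So the wrong `θ` eventually has rank `r + 1
> q`.

The condition on distance ties serves to exclude atoms: the inputs are then almost surely distinct,
as Stone's lemma requires. -/

namespace KnnRegion

/-! ### Ranks with tie-breaking and nearest neighbours -/

section Combinatorics

open Classical in
/-- Exactly `min q N` of `N` items with distinct keys have fewer than `q` predecessors. -/
theorem card_filter_card_lt {ι L : Type*} [Fintype ι] [LinearOrder L] (key : ι → L)
    (hkey : Function.Injective key) (q : ℕ) :
    Finset.card {i : ι | Finset.card {l : ι | key l < key i} < q} = min q (Fintype.card ι) := by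
  set ρ : ι → ℕ := fun i => Finset.card {l : ι | key l < key i} with hρ
  have hlt : ∀ i j, key i < key j → ρ i < ρ j := by
    intro i j hij
    apply Finset.card_lt_card
    rw [Finset.ssubset_iff_of_subset]
    · exact ⟨i, by simp [hij], by simp⟩
    · intro l hl
      simp only [Finset.mem_filter, Finset.mem_univ, true_and] at hl ⊢
      exact hl.trans hij
  have hinj : Function.Injective ρ := by
    intro i j hij
    rcases lt_trichotomy (key i) (key j) with h | h | h
    · exact absurd hij (hlt _ _ h).ne
    · exact hkey h
    · exact absurd hij (hlt _ _ h).ne'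
  -- An injection of `N` items into `N` possible ranks attains every rank.
  have himg : Finset.univ.image ρ = Finset.range (Fintype.card ι) := by
    apply Finset.eq_of_subset_of_card_le
    · intro t ht
      obtain ⟨i, -, rfl⟩ := Finset.mem_image.1 ht
      rw [Finset.mem_range, ← Finset.card_univ]
      apply Finset.card_lt_card
      rw [Finset.ssubset_iff_of_subset (Finset.subset_univ _)]
      exact ⟨i, by simp, by simp⟩
    · rw [Finset.card_image_of_injective _ hinj, Finset.card_univ, Finset.card_range]
  have h1 : (Finset.univ.filter fun i => ρ i < q).image ρ
      = (Finset.range (Fintype.card ι)).filter (· < q) := by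
    rw [← himg, Finset.filter_image]
  have h2 : (Finset.range (Fintype.card ι)).filter (· < q)
      = Finset.range (min q (Fintype.card ι)) := by
    ext t; simp [and_comm]
  rw [← Finset.card_image_of_injective _ hinj, h1, h2, Finset.card_range]

theorem injective_toLex_perm {n : ℕ} (z : Fin n → ℝ) (p : Equiv.Perm (Fin n)) :
    Function.Injective fun i => toLex (z i, p i) := by
  intro i j hij
  have : (z i, p i) = (z j, p j) := toLex.injective hij
  exact p.injective (Prod.ext_iff.1 this).2

open Classical in
/-- The number of predecessors of `a` when the indices are ordered by `z`, with ties resolved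
by `p`. -/
noncomputable def predCount {n : ℕ} (p : Equiv.Perm (Fin n)) (z : Fin n → ℝ) (a : Fin n) : ℕ :=
  Finset.card {l : Fin n | z l < z a ∨ (z l = z a ∧ p l < p a)}

-- Breaking ties by `p` is the lexicographic order on pairs, whose keys are distinct because `p` is
-- injective.
open Classical in
theorem predCount_eq {n : ℕ} (p : Equiv.Perm (Fin n)) (z : Fin n → ℝ) (a : Fin n) :
    predCount p z a = Finset.card {l : Fin n | toLex (z l, p l) < toLex (z a, p a)} := by
  unfold predCount
  congr 1
  ext l
  simp [Prod.Lex.toLex_lt_toLex]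

open Classical in
theorem card_predCount_lt {n : ℕ} (p : Equiv.Perm (Fin n)) (z : Fin n → ℝ) (q : ℕ) :
    Finset.card {a : Fin n | predCount p z a < q} = min q n := by
  have := card_filter_card_lt _ (injective_toLex_perm z p) q
  simp only [predCount_eq]
  simpa using this

/-- Relabelling values and tie keys together only renames the items. This equivariance drives the
exchangeability argument. -/
theorem predCount_comp_perm {n : ℕ} (p τ : Equiv.Perm (Fin n)) (z : Fin n → ℝ) (a : Fin n) :
    predCount (τ.trans p) (z ∘ τ) a = predCount p z (τ a) := by
  classical
  unfold predCount
  apply Finset.card_bij (fun l _ => τ l)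
  · intro l hl
    exact Finset.mem_filter.2 ⟨Finset.mem_univ _, (Finset.mem_filter.1 hl).2⟩
  · intro l _ l' _ h; exact τ.injective h
  · intro l hl
    refine ⟨τ.symm l, Finset.mem_filter.2 ⟨Finset.mem_univ _, ?_⟩, by simp⟩
    simpa using (Finset.mem_filter.1 hl).2

theorem rank_eq_predCount {r : ℕ} (p : Equiv.Perm (Fin (r + 1))) (z : Fin (r + 1) → ℝ) :
    rank p (z (Fin.last r)) (fun j => z j.castSucc) = 1 + predCount p z (Fin.last r) := by
  classical
  unfold rank predCount
  congr 1
  simp only [Finset.card_filter]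
  rw [Fin.sum_univ_castSucc]
  simp

variable {𝕏 : Type*} [PseudoMetricSpace 𝕏] {n : ℕ}

theorem mem_neighbors_iff (k : ℕ) (s : Equiv.Perm (Fin n)) (xs : Fin n → 𝕏) (x : 𝕏) (i : Fin n) :
    i ∈ neighbors k s xs x ↔ predCount s (fun l => dist (xs l) x) i < k := by
  classical
  unfold neighbors predCount
  simp

/-- Tie-breaking leaves no ambiguity, so for `k ≤ n` the factor `1 / k` turns the sum over
neighbours into a genuine average. -/
theorem card_neighbors (k : ℕ) (s : Equiv.Perm (Fin n)) (xs : Fin n → 𝕏) (x : 𝕏) :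
    (neighbors k s xs x).card = min k n := by
  classical
  rw [← card_predCount_lt s (fun l => dist (xs l) x) k]
  congr 1

/-- If `k` sample points lie within `δ` of `x`, so do all the `k` nearest neighbours. -/
theorem dist_le_of_mem_neighbors {k : ℕ} {s : Equiv.Perm (Fin n)} {xs : Fin n → 𝕏} {x : 𝕏} {δ : ℝ}
    (S : Finset (Fin n)) (hS : ∀ l ∈ S, dist (xs l) x ≤ δ) (hk : k ≤ S.card) {i : Fin n}
    (hi : i ∈ neighbors k s xs x) : dist (xs i) x ≤ δ := by
  classical
  by_contra! h
  rw [mem_neighbors_iff, predCount] at hi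
  have : S.card ≤ _ := Finset.card_le_card (t := {l : Fin n | dist (xs l) x < dist (xs i) x ∨
    (dist (xs l) x = dist (xs i) x ∧ s l < s i)}) (by
      intro l hl
      simp only [Finset.mem_filter, Finset.mem_univ, true_and]
      exact Or.inl ((hS l hl).trans_lt h))
  omega

end Combinatorics

/-! ### Stone's geometric lemma -/

section Stone

variable {E : Type*} [NormedAddCommGroup E] [NormedSpace ℝ E]

/-- Two nonzero vectors whose directions differ by less than `1` are closer to each other than the
longer one is to the origin. -/
theorem norm_sub_lt_of_direction {x y : E} (hx : x ≠ 0) (hxy : ‖x‖ ≤ ‖y‖)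
    (h : ‖‖x‖⁻¹ • x - ‖y‖⁻¹ • y‖ < 1) : ‖x - y‖ < ‖y‖ := by
  have hx0 : 0 < ‖x‖ := norm_pos_iff.2 hx
  have hy0 : 0 < ‖y‖ := hx0.trans_le hxy
  have h1 : x - y = ‖x‖ • (‖x‖⁻¹ • x - ‖y‖⁻¹ • y) + (‖x‖ - ‖y‖) • (‖y‖⁻¹ • y) := by
    rw [smul_sub, sub_smul, smul_smul, smul_smul, smul_smul, mul_inv_cancel₀ hx0.ne',
      mul_inv_cancel₀ hy0.ne', one_smul, one_smul]
    abel
  have h2 : ‖(‖x‖ - ‖y‖) • (‖y‖⁻¹ • y)‖ = ‖y‖ - ‖x‖ := by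
    rw [norm_smul, norm_smul, norm_inv, norm_norm, inv_mul_cancel₀ hy0.ne', mul_one,
      Real.norm_eq_abs, abs_of_nonpos (by linarith)]
    ring
  have h3 : ‖‖x‖ • (‖x‖⁻¹ • x - ‖y‖⁻¹ • y)‖ < ‖x‖ := by
    rw [norm_smul, norm_norm]
    exact mul_lt_of_lt_one_right hx0 h
  calc ‖x - y‖ ≤ ‖‖x‖ • (‖x‖⁻¹ • x - ‖y‖⁻¹ • y)‖ + ‖(‖x‖ - ‖y‖) • (‖y‖⁻¹ • y)‖ := by
        conv_lhs => rw [h1]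
        exact norm_add_le _ _
    _ < ‖x‖ + (‖y‖ - ‖x‖) := by rw [h2]; linarith
    _ = ‖y‖ := by ring

open Classical in
/-- **Stone's lemma**: among distinct points, a point is one of the `k` nearest neighbours of at
most `γ * k` points, where `γ` only depends on the space. -/
theorem exists_card_mem_neighbors_le (E : Type*) [NormedAddCommGroup E] [NormedSpace ℝ E]
    [FiniteDimensional ℝ E] :
    ∃ γ : ℕ, ∀ (n k : ℕ) (s : Equiv.Perm (Fin n)) (xs : Fin n → E), Function.Injective xs →
      ∀ l, Finset.card {i : Fin n | l ∈ neighbors k s xs (xs i)} ≤ γ * k := by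
  have : ProperSpace E := FiniteDimensional.proper_real E
  -- Radius `1 / 2` makes any two directions in one ball differ by less than `1`.
  obtain ⟨T, -, hTfin, hT⟩ := finite_cover_balls_of_compact (isCompact_sphere (0 : E) 1)
    (show (0 : ℝ) < 1 / 2 by norm_num)
  lift T to Finset E using hTfin
  -- Each cone of directions contributes at most `k` points; the extra `1` accounts for `l` itself.
  refine ⟨T.card + 1, fun n k s xs hxs l => ?_⟩
  rcases Nat.eq_zero_or_pos k with rfl | hk
  · simp [mem_neighbors_iff]
  set dir : Fin n → E := fun i => ‖xs i - xs l‖⁻¹ • (xs i - xs l) with hdir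
  set S : E → Finset (Fin n) := fun t =>
    {i : Fin n | i ≠ l ∧ l ∈ neighbors k s xs (xs i) ∧ dir i ∈ Metric.ball t (1 / 2)} with hS
  have hne : ∀ i, i ≠ l → xs i - xs l ≠ 0 := fun i hi => sub_ne_zero.2 (hxs.ne hi)
  -- Let `i₀` be the point of the cone farthest from `l`. Every point of the cone is closer to `i₀`
  -- than `l` is, hence precedes `l` among the neighbours of `i₀`; fewer than `k` points do.
  have hSk : ∀ t, (S t).card ≤ k := by
    intro t
    rcases (S t).eq_empty_or_nonempty with h | h
    · simp [h]
    obtain ⟨i₀, hi₀, hmax⟩ := Finset.exists_max_image (S t) (fun i => ‖xs i - xs l‖) h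
    have hi₀' := hi₀
    simp only [hS, Finset.mem_filter, Finset.mem_univ, true_and] at hi₀'
    obtain ⟨hil, hmem, hball⟩ := hi₀'
    rw [mem_neighbors_iff, predCount] at hmem
    refine (Finset.card_le_card ?_).trans hmem.le
    intro i hi
    have hle := hmax i hi
    simp only [hS, Finset.mem_filter, Finset.mem_univ, true_and] at hi ⊢
    obtain ⟨hil', -, hball'⟩ := hi
    left
    have hd : ‖dir i - dir i₀‖ < 1 := by
      rw [← dist_eq_norm]
      calc dist (dir i) (dir i₀) ≤ dist (dir i) t + dist (dir i₀) t := dist_triangle_right _ _ _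
        _ < 1 / 2 + 1 / 2 := add_lt_add (Metric.mem_ball.1 hball') (Metric.mem_ball.1 hball)
        _ = 1 := by norm_num
    have := norm_sub_lt_of_direction (hne i hil') hle hd
    rw [dist_eq_norm, dist_eq_norm, norm_sub_rev (xs l)]
    simpa using this
  have hsub : (Finset.univ.filter fun i => l ∈ neighbors k s xs (xs i))
      ⊆ insert l (T.biUnion S) := by
    intro i hi
    simp only [Finset.mem_filter, Finset.mem_univ, true_and] at hi
    by_cases hil : i = l
    · simp [hil]
    · have hsph : dir i ∈ Metric.sphere (0 : E) 1 := by
        rw [mem_sphere_zero_iff_norm, hdir, norm_smul, norm_inv, norm_norm,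
          inv_mul_cancel₀ (norm_ne_zero_iff.2 (hne i hil))]
      obtain ⟨t, ht, hb⟩ := Set.mem_iUnion₂.1 (hT hsph)
      refine Finset.mem_insert_of_mem (Finset.mem_biUnion.2 ⟨t, ht, ?_⟩)
      simp only [hS, Finset.mem_filter, Finset.mem_univ, true_and]
      exact ⟨hil, hi, hb⟩
  calc _ ≤ (insert l (T.biUnion S)).card := Finset.card_le_card hsub
    _ ≤ (T.biUnion S).card + 1 := Finset.card_insert_le _ _
    _ ≤ T.card * k + 1 := by
        gcongr
        exact Finset.card_biUnion_le_card_mul _ _ _ fun t _ => hSk t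
    _ ≤ (T.card + 1) * k := by rw [add_mul]; omega

end Stone

/-! ### Deterministic bias bound -/

section Bias

open Classical in
/-- A deterministic bound for the squared bias of averages over neighbourhoods `N i`: the values
`G` are compared with values `H` that vary little over the neighbourhoods of all `i ∉ B`. -/
theorem sum_sq_sub_avg_le {n k : ℕ} (hk : 0 < k) (N : Fin n → Finset (Fin n))
    (hN : ∀ i, (N i).card = k) (γ : ℕ)
    (hγ : ∀ l, Finset.card {i : Fin n | l ∈ N i} ≤ γ * k) (G H : Fin n → ℝ) {M ε : ℝ}
    (hε : 0 ≤ ε) (hM : ∀ i, |H i| ≤ M) (B : Finset (Fin n))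
    (hB : ∀ i, i ∉ B → ∀ l ∈ N i, (H i - H l) ^ 2 ≤ ε) :
    ∑ i, (G i - 1 / (k : ℝ) * ∑ l ∈ N i, G l) ^ 2 ≤
      3 * (1 + γ) * ∑ i, (G i - H i) ^ 2 + 3 * (n * ε + 4 * M ^ 2 * B.card) := by
  have hk0 : (0 : ℝ) < k := by exact_mod_cast hk
  set d : Fin n → ℝ := fun i => (G i - H i) ^ 2 with hd
  have hpt : ∀ i, (G i - 1 / (k : ℝ) * ∑ l ∈ N i, G l) ^ 2 ≤
      3 * d i + 3 * (1 / (k : ℝ) * ∑ l ∈ N i, d l) + 3 * (ε + if i ∈ B then 4 * M ^ 2 else 0) := by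
    intro i
    -- Since `N i` has exactly `k` elements, `G i` is its own average over `N i`, and Cauchy–Schwarz
    -- applies to the differences.
    have h1 : G i - 1 / (k : ℝ) * ∑ l ∈ N i, G l = 1 / (k : ℝ) * ∑ l ∈ N i, (G i - G l) := by
      rw [Finset.sum_sub_distrib, Finset.sum_const, hN, nsmul_eq_mul]
      field_simp
    have h2 : (∑ l ∈ N i, (G i - G l)) ^ 2 ≤ k * ∑ l ∈ N i, (G i - G l) ^ 2 := by
      have := sq_sum_le_card_mul_sum_sq (s := N i) (f := fun l => G i - G l)
      rwa [hN] at this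
    have h3 : ∀ l ∈ N i, (G i - G l) ^ 2 ≤
        3 * d i + 3 * d l + 3 * (ε + if i ∈ B then 4 * M ^ 2 else 0) := by
      intro l hl
      have h4 : (H i - H l) ^ 2 ≤ ε + if i ∈ B then 4 * M ^ 2 else 0 := by
        split_ifs with h
        · have a1 := abs_le.1 (hM i)
          have a2 := abs_le.1 (hM l)
          nlinarith
        · simpa using hB i h l hl
      have h5 : (G i - G l) ^ 2 ≤ 3 * d i + 3 * d l + 3 * (H i - H l) ^ 2 := by
        simp only [hd]
        nlinarith [sq_nonneg ((G i - H i) + (G l - H l)),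
          sq_nonneg ((G i - H i) - (H i - H l)), sq_nonneg ((G l - H l) + (H i - H l))]
      linarith
    calc (G i - 1 / (k : ℝ) * ∑ l ∈ N i, G l) ^ 2
        = (1 / (k : ℝ)) ^ 2 * (∑ l ∈ N i, (G i - G l)) ^ 2 := by rw [h1, mul_pow]
      _ ≤ (1 / (k : ℝ)) ^ 2 * (k * ∑ l ∈ N i, (G i - G l) ^ 2) := by gcongr
      _ = 1 / (k : ℝ) * ∑ l ∈ N i, (G i - G l) ^ 2 := by field_simp
      _ ≤ 1 / (k : ℝ) * ∑ l ∈ N i,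
          (3 * d i + 3 * d l + 3 * (ε + if i ∈ B then 4 * M ^ 2 else 0)) := by
          gcongr with l hl
          exact h3 l hl
      _ = _ := by
          rw [Finset.sum_add_distrib, Finset.sum_add_distrib, Finset.sum_const, Finset.sum_const,
            hN, ← Finset.mul_sum, nsmul_eq_mul, nsmul_eq_mul]
          field_simp
  -- Double counting: each `d l` appears once for every neighbourhood containing `l`, at most `γ *
  -- k` times.
  have hswap : ∑ i, (1 / (k : ℝ) * ∑ l ∈ N i, d l) ≤ γ * ∑ l, d l := by
    rw [← Finset.mul_sum]
    have h1 : ∑ i, ∑ l ∈ N i, d l = ∑ l, (Finset.card {i : Fin n | l ∈ N i} : ℝ) * d l := by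
      have : ∀ i, ∑ l ∈ N i, d l = ∑ l, if l ∈ N i then d l else 0 := by
        intro i; rw [← Finset.sum_filter]; congr 1; ext; simp
      simp_rw [this]
      rw [Finset.sum_comm]
      refine Finset.sum_congr rfl fun l _ => ?_
      rw [← Finset.sum_filter, Finset.sum_const, nsmul_eq_mul]
    rw [h1]
    have h2 : ∑ l, (Finset.card {i : Fin n | l ∈ N i} : ℝ) * d l ≤ ∑ l, (γ * k : ℝ) * d l := by
      refine Finset.sum_le_sum fun l _ => mul_le_mul_of_nonneg_right ?_ (sq_nonneg _)
      exact_mod_cast hγ l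
    calc _ ≤ 1 / (k : ℝ) * ∑ l, (γ * k : ℝ) * d l := by gcongr
      _ = γ * ∑ l, d l := by rw [← Finset.mul_sum]; field_simp
  calc _ ≤ ∑ i, (3 * d i + 3 * (1 / (k : ℝ) * ∑ l ∈ N i, d l)
        + 3 * (ε + if i ∈ B then 4 * M ^ 2 else 0)) := Finset.sum_le_sum fun i _ => hpt i
    _ = 3 * ∑ i, d i + 3 * ∑ i, (1 / (k : ℝ) * ∑ l ∈ N i, d l)
        + 3 * (n * ε + 4 * M ^ 2 * B.card) := by
        rw [Finset.sum_add_distrib, Finset.sum_add_distrib, ← Finset.mul_sum, ← Finset.mul_sum,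
          ← Finset.mul_sum Finset.univ (fun i => ε + _), Finset.sum_add_distrib, ← Finset.sum_filter]
        simp [mul_comm]
    _ ≤ _ := by linarith

end Bias

/-! ### Measurability of the procedure -/

section Measurability

instance permDiscrete (n : ℕ) : DiscreteMeasurableSpace (Equiv.Perm (Fin n)) :=
  ⟨fun _ => trivial⟩

theorem measurable_sgn : Measurable sgn := by
  unfold sgn
  exact Measurable.ite measurableSet_Ici measurable_const measurable_const

variable {α : Type*} [MeasurableSpace α]

theorem measurable_predCount {n : ℕ} {p : α → Equiv.Perm (Fin n)} (hp : Measurable p)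
    {z : α → Fin n → ℝ} (hz : ∀ l, Measurable fun w => z w l) (a : Fin n) :
    Measurable fun w => predCount (p w) (z w) a := by
  classical
  unfold predCount
  simp only [Finset.card_filter]
  refine Finset.measurable_sum _ fun l _ => Measurable.ite ?_ measurable_const measurable_const
  refine (measurableSet_lt (hz l) (hz a)).union
    ((measurableSet_eq_fun (hz l) (hz a)).inter ?_)
  exact hp (MeasurableSet.of_discrete (s := {p : Equiv.Perm (Fin n) | p l < p a}))

variable {𝕏 : Type*} [PseudoMetricSpace 𝕏] [MeasurableSpace 𝕏] [OpensMeasurableSpace 𝕏]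
  [SecondCountableTopology 𝕏] {n : ℕ}

theorem measurableSet_mem_neighbors (k : ℕ) {s : α → Equiv.Perm (Fin n)} (hs : Measurable s)
    {xs : α → Fin n → 𝕏} (hxs : ∀ l, Measurable fun w => xs w l) {x : α → 𝕏} (hx : Measurable x)
    (i : Fin n) : MeasurableSet {w | i ∈ neighbors k (s w) (xs w) (x w)} := by
  simp only [mem_neighbors_iff]
  exact measurable_predCount hs (fun l => (hxs l).dist hx) i measurableSet_Iio

theorem measurable_knnEstimate (k : ℕ) {s : α → Equiv.Perm (Fin n)} (hs : Measurable s)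
    {D : α → Fin n → 𝕏 × Label} (hD : ∀ l, Measurable fun w => D w l) {x : α → 𝕏}
    (hx : Measurable x) : Measurable fun w => knnEstimate k (s w) (D w) (x w) := by
  classical
  unfold knnEstimate
  refine Measurable.const_mul ?_ _
  have : ∀ w, ∑ i ∈ neighbors k (s w) (fun l => (D w l).1) (x w), ((D w i).2 : ℝ)
      = ∑ i, if i ∈ neighbors k (s w) (fun l => (D w l).1) (x w) then ((D w i).2 : ℝ) else 0 := by
    intro w
    rw [← Finset.sum_filter]
    congr 1
    ext
    simp
  simp only [this]
  refine Finset.measurable_sum _ fun i _ => Measurable.ite ?_ ?_ measurable_const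
  · exact measurableSet_mem_neighbors k hs (fun l => (hD l).fst) hx i
  · exact measurable_subtype_coe.comp (hD i).snd

theorem measurable_refVar (k : ℕ) {g : 𝕏 → ℝ} (hg : Measurable g) {s : α → Equiv.Perm (Fin n)}
    (hs : Measurable s) {D : α → Fin n → 𝕏 × Label} (hD : ∀ l, Measurable fun w => D w l) :
    Measurable fun w => refVar k (s w) g (D w) := by
  unfold refVar
  refine Measurable.const_mul (Finset.measurable_sum _ fun i _ => ?_) _
  exact ((hg.comp (hD i).fst).sub (measurable_knnEstimate k hs hD (hD i).fst)).pow_const 2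

end Measurability

/-! ### The uniform law and the mean of a generated label -/

section Uniform

/-- The uniform distribution on `[-1, 1]`. -/
noncomputable def unif : Measure ℝ := volume[|Set.Icc (-1 : ℝ) 1]

instance isProbabilityMeasure_unif : IsProbabilityMeasure unif :=
  cond_isProbabilityMeasure_of_finite (by simp [Real.volume_Icc]) (by simp [Real.volume_Icc])

theorem unif_nonneg_add {a : ℝ} (ha : a ∈ Set.Icc (-1 : ℝ) 1) :
    unif {v | 0 ≤ a + v} = ENNReal.ofReal ((1 + a) / 2) := by
  have h : Set.Icc (-1 : ℝ) 1 ∩ {v | 0 ≤ a + v} = Set.Icc (-a) 1 := by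
    ext v
    simp only [Set.mem_inter_iff, Set.mem_Icc, Set.mem_ofPred_eq]
    constructor
    · rintro ⟨⟨_, h2⟩, h3⟩; exact ⟨by linarith, h2⟩
    · rintro ⟨h1, h2⟩; exact ⟨⟨by linarith [ha.2], h2⟩, by linarith⟩
  rw [unif, cond_apply measurableSet_Icc, h, Real.volume_Icc, Real.volume_Icc,
    ← ENNReal.ofReal_inv_of_pos (by norm_num), ← ENNReal.ofReal_mul (by norm_num)]
  congr 1
  ring

theorem integral_sgn_unif {a : ℝ} (ha : a ∈ Set.Icc (-1 : ℝ) 1) :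
    ∫ v, (sgn (a + v) : ℝ) ∂unif = a := by
  have hm : MeasurableSet {v : ℝ | 0 ≤ a + v} :=
    measurableSet_le measurable_const (measurable_const.add measurable_id)
  have h : ∀ v, (sgn (a + v) : ℝ) = 2 * Set.indicator {v : ℝ | 0 ≤ a + v} 1 v - 1 := by
    intro v
    by_cases hv : 0 ≤ a + v <;> (simp [sgn, hv]; try norm_num)
  simp_rw [h]
  have hint : Integrable (Set.indicator {v : ℝ | 0 ≤ a + v} (1 : ℝ → ℝ)) unif :=
    (integrable_const (1 : ℝ)).indicator hm
  rw [integral_sub (hint.const_mul 2) (by simp), integral_const_mul,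
    integral_indicator_one hm, measureReal_def, unif_nonneg_add ha,
    ENNReal.toReal_ofReal (by linarith [ha.1])]
  simp
  ring

end Uniform

/-! ### Representing the data law by uniform noise -/

section Law

variable {𝕏 : Type*} [MeasurableSpace 𝕏]

theorem Label.eq_one_or (y : Label) : (y = ⟨1, by simp⟩) ∨ (y = ⟨-1, by simp⟩) := by
  rcases y with ⟨y, hy | hy⟩
  · left; exact Subtype.ext hy
  · right; exact Subtype.ext hy

/-- The labels with regression function `g` can be generated as `sgn (g x + v)`, `v` uniform. -/
theorem map_sgn_eq {Q : Measure (𝕏 × Label)} [IsProbabilityMeasure Q] {g : 𝕏 → ℝ}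
    (hg : Measurable g) (hg1 : ∀ x, g x ∈ Set.Icc (-1 : ℝ) 1) (hQ : IsRegressionFunction Q g) :
    (Q.fst.prod unif).map (fun p => (p.1, sgn (g p.1 + p.2))) = Q := by
  have hΦ : Measurable fun p : 𝕏 × ℝ => (p.1, sgn (g p.1 + p.2)) :=
    measurable_fst.prodMk (measurable_sgn.comp ((hg.comp measurable_fst).add measurable_snd))
  set Q' := (Q.fst.prod unif).map (fun p => (p.1, sgn (g p.1 + p.2))) with hQ'
  have : IsProbabilityMeasure Q' := Measure.isProbabilityMeasure_map hΦ.aemeasurable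
  have huniv : ∀ A : Set 𝕏, MeasurableSet A → Q' (A ×ˢ Set.univ) = Q (A ×ˢ Set.univ) := by
    intro A hA
    rw [hQ', Measure.map_apply hΦ (hA.prod MeasurableSet.univ)]
    have : (fun p : 𝕏 × ℝ => (p.1, sgn (g p.1 + p.2))) ⁻¹' (A ×ˢ Set.univ) = A ×ˢ Set.univ := by
      ext p; simp
    rw [this, Measure.prod_prod, measure_univ, mul_one, Measure.fst_apply hA, Set.prod_univ]
  set e : Label := ⟨1, by simp⟩ with he
  set e' : Label := ⟨-1, by simp⟩ with he'
  have hne : e' ≠ e := by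
    intro h
    have : (-1 : ℝ) = 1 := congrArg Subtype.val h
    norm_num at this
  have hone : ∀ A : Set 𝕏, MeasurableSet A → Q' (A ×ˢ {e}) = Q (A ×ˢ {e}) := by
    intro A hA
    have h1 : Q' (A ×ˢ {e}) = ∫⁻ x in A, ENNReal.ofReal ((1 + g x) / 2) ∂Q.fst := by
      rw [hQ', Measure.map_apply hΦ (hA.prod (MeasurableSet.singleton e)),
        Measure.prod_apply (hΦ (hA.prod (MeasurableSet.singleton e))),
        ← lintegral_indicator hA]
      refine lintegral_congr fun x => ?_
      by_cases hx : x ∈ A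
      · rw [Set.indicator_of_mem hx, ← unif_nonneg_add (hg1 x)]
        congr 1
        ext v
        by_cases hv : 0 ≤ g x + v
        · simp [hx, sgn, hv, he]
        · simpa [hx, sgn, hv] using hne
      · rw [Set.indicator_of_notMem hx]
        convert measure_empty (μ := unif)
        ext v
        simp [hx]
    have hle : MeasurableSpace.comap (Prod.fst : 𝕏 × Label → 𝕏) inferInstance ≤
        (inferInstance : MeasurableSpace (𝕏 × Label)) := measurable_fst.comap_le
    have hbd : ∀ y : Label, |(y : ℝ)| ≤ 1 := by
      intro y; rcases y.eq_one_or with h | h <;> simp [h]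
    have hint : Integrable (fun p : 𝕏 × Label => (p.2 : ℝ)) Q :=
      Integrable.of_bound (measurable_subtype_coe.comp measurable_snd).aestronglyMeasurable 1
        (Eventually.of_forall fun p => hbd p.2)
    have hgint : Integrable (fun p : 𝕏 × Label => g p.1) Q :=
      Integrable.of_bound (hg.comp measurable_fst).aestronglyMeasurable 1
        (Eventually.of_forall fun p => abs_le.2 (hg1 p.1))
    -- The averaging property of conditional expectation on the set `A ×ˢ univ`, which depends on
    -- the input alone.
    have hset : ∫ p in A ×ˢ Set.univ, (p.2 : ℝ) ∂Q = ∫ p in A ×ˢ Set.univ, g p.1 ∂Q := by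
      rw [← setIntegral_condExp hle hint (s := A ×ˢ Set.univ) ⟨A, hA, by ext; simp⟩]
      exact setIntegral_congr_ae (hA.prod MeasurableSet.univ)
        (hQ.mono fun p hp _ => hp.symm)
    -- For a label `y`, the indicator of `y = 1` equals `(1 + y) / 2`.
    have h2 : Q (A ×ˢ {e}) = ∫⁻ p in A ×ˢ Set.univ, ENNReal.ofReal ((1 + (p.2 : ℝ)) / 2) ∂Q := by
      rw [← lintegral_indicator (hA.prod MeasurableSet.univ),
        ← lintegral_indicator_one (hA.prod (MeasurableSet.singleton e))]
      refine lintegral_congr fun p => ?_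
      by_cases hx : p.1 ∈ A
      · rcases p.2.eq_one_or with h | h
        · rw [Set.indicator_of_mem (show p ∈ A ×ˢ {e} from ⟨hx, h⟩),
            Set.indicator_of_mem (show p ∈ A ×ˢ Set.univ from ⟨hx, Set.mem_univ _⟩), h]
          norm_num
        · rw [Set.indicator_of_notMem,
            Set.indicator_of_mem (show p ∈ A ×ˢ Set.univ from ⟨hx, Set.mem_univ _⟩), h]
          · norm_num
          · rintro ⟨_, h'⟩
            exact hne (h.symm.trans h')
      · rw [Set.indicator_of_notMem (fun h => hx h.1), Set.indicator_of_notMem (fun h => hx h.1)]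
    have h3 : ∫⁻ x in A, ENNReal.ofReal ((1 + g x) / 2) ∂Q.fst =
        ∫⁻ p in A ×ˢ Set.univ, ENNReal.ofReal ((1 + g p.1) / 2) ∂Q := by
      rw [Measure.fst, setLIntegral_map hA (by fun_prop) measurable_fst, Set.prod_univ]
    rw [h1, h2, h3,
      ← ofReal_integral_eq_lintegral_ofReal, ← ofReal_integral_eq_lintegral_ofReal]
    · congr 1
      rw [integral_div, integral_div, integral_add (by simp) hgint.integrableOn,
        integral_add (by simp) hint.integrableOn, hset]
    · exact (((integrable_const _).add hint).div_const 2).integrableOn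
    · exact Eventually.of_forall fun p => by
        have := (abs_le.1 (hbd p.2)).1
        simp only [Pi.zero_apply]; linarith
    · exact (((integrable_const _).add hgint).div_const 2).integrableOn
    · exact Eventually.of_forall fun p => by
        have := (hg1 p.1).1
        simp only [Pi.zero_apply]; linarith
  have hneg : ∀ A : Set 𝕏, MeasurableSet A → Q' (A ×ˢ {e'}) = Q (A ×ˢ {e'}) := by
    intro A hA
    have hdiff : A ×ˢ {e'} = A ×ˢ (Set.univ : Set Label) \ A ×ˢ {e} := by
      ext p
      rcases p.2.eq_one_or with h | h
      · simp [h, he, he']; intro _ h'; norm_num at h'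
      · simp [h, he, he']; intro _; norm_num
    rw [hdiff, measure_sdiff (Set.prod_mono le_rfl (Set.subset_univ _))
        (hA.prod (MeasurableSet.singleton e)).nullMeasurableSet (measure_ne_top _ _),
      measure_sdiff (Set.prod_mono le_rfl (Set.subset_univ _))
        (hA.prod (MeasurableSet.singleton e)).nullMeasurableSet (measure_ne_top _ _),
      huniv A hA, hone A hA]
  refine Measure.ext_prod fun {A t} hA ht => ?_
  have hdec : A ×ˢ t = ⋃ y ∈ t, A ×ˢ {y} := by
    ext p
    simp only [Set.mem_prod, Set.mem_iUnion, exists_prop, Set.mem_singleton_iff]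
    exact ⟨fun h => ⟨p.2, h.2, h.1, rfl⟩, fun ⟨y, hy, h1, h2⟩ => ⟨h1, h2 ▸ hy⟩⟩
  rw [hdec, measure_biUnion (Set.to_countable t), measure_biUnion (Set.to_countable t)]
  · refine tsum_congr fun y => ?_
    rcases (y : Label).eq_one_or with h | h
    · rw [h]; exact hone A hA
    · rw [h]; exact hneg A hA
  · intro y _ y' _ hyy
    exact Set.disjoint_prod.2 (Or.inr (by simpa using hyy))
  · exact fun y _ => hA.prod (MeasurableSet.singleton y)
  · intro y _ y' _ hyy
    exact Set.disjoint_prod.2 (Or.inr (by simpa using hyy))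
  · exact fun y _ => hA.prod (MeasurableSet.singleton y)

end Law

/-! ### Invariances of product measures -/

section Product

variable {A W V C : Type*} [MeasurableSpace A] [MeasurableSpace W] [MeasurableSpace V]
  [MeasurableSpace C]

theorem sFinite_of_isProbabilityMeasure (a : Measure A) [IsProbabilityMeasure a] : SFinite a :=
  inferInstance

/-- Intended for inputs `a`, permutations `w`, last column `v` and other columns `c`: it places the
last column beside the inputs that it labels. -/
theorem measurePreserving_rearrange (a : Measure A) (w : Measure W) (v : Measure V)
    (c : Measure C) [IsProbabilityMeasure a] [IsProbabilityMeasure w] [IsProbabilityMeasure v]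
    [IsProbabilityMeasure c] :
    MeasurePreserving (fun z : (A × W) × (V × C) => ((z.1.1, z.2.1), (z.2.2, z.1.2)))
      ((a.prod w).prod (v.prod c)) ((a.prod v).prod (c.prod w)) := by
  have h1 := measurePreserving_prodAssoc a w (v.prod c)
  have h2 : MeasurePreserving (Prod.map id Prod.swap) (a.prod (w.prod (v.prod c)))
      (a.prod ((v.prod c).prod w)) := (MeasurePreserving.id a).prod Measure.measurePreserving_swap
  have h3 : MeasurePreserving (Prod.map id MeasurableEquiv.prodAssoc) (a.prod ((v.prod c).prod w))
      (a.prod (v.prod (c.prod w))) :=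
    (MeasurePreserving.id a).prod (measurePreserving_prodAssoc v c w)
  have h4 := (measurePreserving_prodAssoc a v (c.prod w)).symm
  exact h4.comp (h3.comp (h2.comp h1))

theorem map_uncurry_pi {ι κ : Type*} [Fintype ι] [Fintype κ] (P : Measure ℝ)
    [IsProbabilityMeasure P] :
    MeasurePreserving (fun (c : κ → ι → ℝ) (p : ι × κ) => c p.2 p.1)
      (Measure.pi fun _ => Measure.pi fun _ => P) (Measure.pi fun _ => P) := by
  have hm : Measurable fun (c : κ → ι → ℝ) (p : ι × κ) => c p.2 p.1 := by fun_prop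
  refine ⟨hm, (Measure.pi_eq fun s hs => ?_).symm⟩
  rw [Measure.map_apply hm (MeasurableSet.univ_pi hs)]
  have : (fun (c : κ → ι → ℝ) (p : ι × κ) => c p.2 p.1) ⁻¹' (Set.univ.pi s) =
      Set.univ.pi fun j => Set.univ.pi fun i => s (i, j) := by
    ext c
    simp only [Set.mem_preimage, Set.mem_pi, Set.mem_univ, true_imp_iff, Prod.forall]
    exact ⟨fun h j i => h i j, fun h i j => h j i⟩
  rw [this, Measure.pi_pi]
  simp only [Measure.pi_pi]
  rw [Fintype.prod_prod_type_right]

theorem measurePreserving_comp_perm {κ S : Type*} [Fintype κ] [MeasurableSpace S] (P : Measure S)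
    [IsProbabilityMeasure P] (τ : Equiv.Perm κ) :
    MeasurePreserving (fun c : κ → S => c ∘ τ) (Measure.pi fun _ => P) (Measure.pi fun _ => P) := by
  have hm : Measurable fun c : κ → S => c ∘ τ :=
    measurable_pi_lambda _ fun j => measurable_pi_apply (τ j)
  refine ⟨hm, (Measure.pi_eq fun s hs => ?_).symm⟩
  rw [Measure.map_apply hm (MeasurableSet.univ_pi hs)]
  have : (fun c : κ → S => c ∘ τ) ⁻¹' (Set.univ.pi s) = Set.univ.pi (s ∘ τ.symm) := by
    ext c
    simp only [Set.mem_preimage, Set.mem_pi, Set.mem_univ, true_imp_iff, Function.comp_apply]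
    exact ⟨fun h j => by simpa using h (τ.symm j), fun h j => by simpa using h (τ j)⟩
  rw [this, Measure.pi_pi]
  exact Equiv.prod_comp τ.symm fun j => P (s j)

theorem measurePreserving_perm_trans {m : ℕ} (τ : Equiv.Perm (Fin m)) :
    MeasurePreserving (fun p : Equiv.Perm (Fin m) => τ.trans p) (uniformOn Set.univ)
      (uniformOn Set.univ) := by
  refine ⟨Measurable.of_discrete, ?_⟩
  ext s hs
  rw [Measure.map_apply Measurable.of_discrete hs, uniformOn_univ, uniformOn_univ]
  congr 1
  have hinj : Function.Injective fun p : Equiv.Perm (Fin m) => τ.trans p := by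
    intro p p' h
    ext i
    have := congrArg (fun e : Equiv.Perm (Fin m) => e (τ.symm i)) h
    simpa using congrArg Fin.val this
  have hsurj : Function.Surjective fun p : Equiv.Perm (Fin m) => τ.trans p := by
    intro p
    refine ⟨τ.symm.trans p, ?_⟩
    ext i
    simp
  conv_rhs => rw [← Set.image_preimage_eq s hsurj]
  exact (Measure.count_injective_image hinj _).symm

end Product

/-! ### The symmetric model behind the observed variables -/

section JointLaw

variable {𝕏 : Type*} [MeasurableSpace 𝕏] {n : ℕ}

/-- The joint law of the inputs (with marginal `P`), the two permutations, and `r + 1` columns of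
uniform variables, all independent. -/
noncomputable def jointLaw (P : Measure 𝕏) (S : Measure (Equiv.Perm (Fin n))) (r : ℕ) :
    Measure (((Fin n → 𝕏) × (Equiv.Perm (Fin (r + 1)) × Equiv.Perm (Fin n))) ×
      (Fin (r + 1) → Fin n → ℝ)) :=
  ((Measure.pi fun _ => P).prod ((uniformOn Set.univ).prod S)).prod
    (Measure.pi fun _ => Measure.pi fun _ => unif)

/-- The inputs `x`, labelled by means of `g` and the uniform variables `v`. -/
noncomputable def labelled (g : 𝕏 → ℝ) (x : Fin n → 𝕏) (v : Fin n → ℝ) : Fin n → 𝕏 × Label :=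
  fun i => (x i, sgn (g (x i) + v i))

theorem measurable_labelled {g : 𝕏 → ℝ} (hg : Measurable g) :
    Measurable fun p : (Fin n → 𝕏) × (Fin n → ℝ) => labelled g p.1 p.2 := by
  refine measurable_pi_lambda _ fun i => ?_
  have h1 : Measurable fun p : (Fin n → 𝕏) × (Fin n → ℝ) => p.1 i := by fun_prop
  have h2 : Measurable fun p : (Fin n → 𝕏) × (Fin n → ℝ) => p.2 i := by fun_prop
  exact h1.prodMk (measurable_sgn.comp ((hg.comp h1).add h2))

theorem measurePreserving_labelled {Q : Measure (𝕏 × Label)} [IsProbabilityMeasure Q] {g : 𝕏 → ℝ}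
    (hg : Measurable g) (hg1 : ∀ x, g x ∈ Set.Icc (-1 : ℝ) 1) (hQ : IsRegressionFunction Q g) :
    MeasurePreserving (fun p : (Fin n → 𝕏) × (Fin n → ℝ) => labelled g p.1 p.2)
      ((Measure.pi fun _ => Q.fst).prod (Measure.pi fun _ => unif)) (Measure.pi fun _ => Q) := by
  have hΦ : Measurable fun p : 𝕏 × ℝ => (p.1, sgn (g p.1 + p.2)) :=
    measurable_fst.prodMk (measurable_sgn.comp ((hg.comp measurable_fst).add measurable_snd))
  have h1 := (measurePreserving_arrowProdEquivProdArrow 𝕏 ℝ (Fin n) (fun _ => Q.fst)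
    (fun _ => unif)).symm
  have h2 : MeasurePreserving (fun p : 𝕏 × ℝ => (p.1, sgn (g p.1 + p.2))) (Q.fst.prod unif) Q :=
    ⟨hΦ, map_sgn_eq hg hg1 hQ⟩
  exact (measurePreserving_pi (fun _ : Fin n => Q.fst.prod unif) (fun _ : Fin n => Q)
    (fun _ => h2)).comp h1

variable {r : ℕ}

/-- The observed variables (sample, array, permutations), where the last column of uniform variables
generates the labels of the sample. -/
noncomputable def observed (g : 𝕏 → ℝ)
    (w : ((Fin n → 𝕏) × (Equiv.Perm (Fin (r + 1)) × Equiv.Perm (Fin n))) ×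
      (Fin (r + 1) → Fin n → ℝ)) :
    (Fin n → 𝕏 × Label) × ((Fin n × Fin r → ℝ) ×
      (Equiv.Perm (Fin (r + 1)) × Equiv.Perm (Fin n))) :=
  (labelled g w.1.1 (w.2 (Fin.last r)), (fun p => w.2 p.2.castSucc p.1, w.1.2))

instance isProbabilityMeasure_uniformOn_perm (m : ℕ) :
    IsProbabilityMeasure (uniformOn (Set.univ : Set (Equiv.Perm (Fin m)))) :=
  isProbabilityMeasure_uniformOn Set.finite_univ Set.univ_nonempty

instance (P : Measure 𝕏) [IsProbabilityMeasure P] (S : Measure (Equiv.Perm (Fin n)))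
    [IsProbabilityMeasure S] : IsProbabilityMeasure (jointLaw P S r) := by
  unfold jointLaw; infer_instance

theorem measurePreserving_observed {Q : Measure (𝕏 × Label)} [IsProbabilityMeasure Q] {g : 𝕏 → ℝ}
    (hg : Measurable g) (hg1 : ∀ x, g x ∈ Set.Icc (-1 : ℝ) 1) (hQ : IsRegressionFunction Q g)
    (S : Measure (Equiv.Perm (Fin n))) [IsProbabilityMeasure S] :
    MeasurePreserving (observed (r := r) g) (jointLaw Q.fst S r)
      ((Measure.pi fun _ => Q).prod ((Measure.pi fun _ => unif).prod
        ((uniformOn Set.univ).prod S))) := by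
  -- Splits off the last column, the one that will generate the labels of the sample.
  have h1 := (MeasurePreserving.id ((Measure.pi fun _ : Fin n => Q.fst).prod
    ((uniformOn (Set.univ : Set (Equiv.Perm (Fin (r + 1))))).prod S))).prod
    (measurePreserving_piFinSuccAbove
      (fun _ : Fin (r + 1) => Measure.pi fun _ : Fin n => unif) (Fin.last r))
  have h2 := measurePreserving_rearrange (Measure.pi fun _ : Fin n => Q.fst)
    ((uniformOn (Set.univ : Set (Equiv.Perm (Fin (r + 1))))).prod S)
    (Measure.pi fun _ : Fin n => unif) (Measure.pi fun _ : Fin r => Measure.pi fun _ : Fin n => unif)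
  have h3 := (map_uncurry_pi (ι := Fin n) (κ := Fin r) unif).prod
    (MeasurePreserving.id ((uniformOn (Set.univ : Set (Equiv.Perm (Fin (r + 1))))).prod S))
  have : SFinite ((Measure.pi fun _ : Fin r => Measure.pi fun _ : Fin n => unif).prod
      ((uniformOn (Set.univ : Set (Equiv.Perm (Fin (r + 1))))).prod S)) :=
    sFinite_of_isProbabilityMeasure _
  have h4 := (measurePreserving_labelled (n := n) hg hg1 hQ).prod h3
  unfold jointLaw
  convert h4.comp (h2.comp h1) using 1
  funext ⟨w, c⟩
  simp [observed, Fin.init]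

end JointLaw

/-! ### Exchangeability and the exact rank probability -/

section Coverage

variable {𝕏 : Type*} [MeasurableSpace 𝕏] {n r : ℕ}

theorem jointLaw_predCount_lt (P : Measure 𝕏) [IsProbabilityMeasure P]
    (S : Measure (Equiv.Perm (Fin n))) [IsProbabilityMeasure S]
    (Z : ((Fin n → 𝕏) × Equiv.Perm (Fin n)) × (Fin n → ℝ) → ℝ) (hZ : Measurable Z)
    {q : ℕ} (hq : q ≤ r + 1) :
    jointLaw P S r {w | predCount w.1.2.1 (fun j => Z ((w.1.1, w.1.2.2), w.2 j)) (Fin.last r) < q} =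
      (q : ℝ≥0∞) / ((r + 1 : ℕ) : ℝ≥0∞) := by
  classical
  set A : Fin (r + 1) → Set (((Fin n → 𝕏) × (Equiv.Perm (Fin (r + 1)) × Equiv.Perm (Fin n))) ×
      (Fin (r + 1) → Fin n → ℝ)) := fun a =>
    {w | predCount w.1.2.1 (fun j => Z ((w.1.1, w.1.2.2), w.2 j)) a < q} with hA
  have hAm : ∀ a, MeasurableSet (A a) := fun a =>
    measurable_predCount (by fun_prop) (fun l => hZ.comp (by fun_prop)) a measurableSet_Iio
  -- The transposition of `a` and the last index acts on the columns and on `π` simultaneously; it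
  -- preserves the law and carries one event to the other.
  have hswap : ∀ a, jointLaw P S r (A a) = jointLaw P S r (A (Fin.last r)) := by
    intro a
    set τ : Equiv.Perm (Fin (r + 1)) := Equiv.swap a (Fin.last r) with hτ
    have h1 := ((MeasurePreserving.id (Measure.pi fun _ : Fin n => P)).prod
      ((measurePreserving_perm_trans τ).prod (MeasurePreserving.id S))).prod
      (measurePreserving_comp_perm (Measure.pi fun _ : Fin n => unif) τ)
    have h2 := h1.measure_preimage (hAm (Fin.last r)).nullMeasurableSet
    rw [jointLaw, ← h2]
    congr 1
    ext w
    have := predCount_comp_perm w.1.2.1 τ (fun j => Z ((w.1.1, w.1.2.2), w.2 j)) (Fin.last r)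
    rw [hτ, Equiv.swap_apply_right] at this
    simp only [hA, Set.mem_preimage, Set.mem_ofPred_eq, ← this]
    rfl
  -- Pointwise, exactly `q` of the events occur, so their probabilities sum to `q`.
  have hsum : ∑ a, jointLaw P S r (A a) = q := by
    calc ∑ a, jointLaw P S r (A a) = ∑ a, ∫⁻ w, (A a).indicator 1 w ∂jointLaw P S r := by
          simp_rw [lintegral_indicator_one (hAm _)]
      _ = ∫⁻ w, ∑ a, (A a).indicator 1 w ∂jointLaw P S r :=
          (lintegral_finsetSum _ fun a _ => measurable_one.indicator (hAm a)).symm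
      _ = ∫⁻ _, (q : ℝ≥0∞) ∂jointLaw P S r := by
          refine lintegral_congr fun w => ?_
          have h := card_predCount_lt w.1.2.1 (fun j => Z ((w.1.1, w.1.2.2), w.2 j)) q
          rw [min_eq_left hq, Finset.card_filter] at h
          rw [← h, Nat.cast_sum]
          refine Finset.sum_congr rfl fun a _ => ?_
          simp [hA, Set.indicator_apply]
      _ = q := by simp
  simp only [hswap, Finset.sum_const, Finset.card_univ, Fintype.card_fin, nsmul_eq_mul] at hsum
  rw [← hsum, mul_comm, ENNReal.mul_div_cancel_right (by simp) (ENNReal.natCast_ne_top _)]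

end Coverage

/-! ### Concentration of the averaged noise -/

section Noise

variable {n : ℕ}

theorem pi_unif_noise_ge_le (S : Finset (Fin n)) {k : ℕ} (hk : 0 < k) (hS : S.card = k)
    (a : Fin n → ℝ) (ha : ∀ i, a i ∈ Set.Icc (-1 : ℝ) 1) {t : ℝ} (ht : 0 ≤ t) :
    (Measure.pi fun _ : Fin n => unif)
      {v | t ≤ |1 / (k : ℝ) * ∑ l ∈ S, (a l - (sgn (a l + v l) : ℝ))|} ≤
      ENNReal.ofReal (2 * Real.exp (-(k * t ^ 2 / 2))) := by
  have hk0 : (0 : ℝ) < k := by exact_mod_cast hk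
  have hmeas : ∀ l, Measurable fun v : ℝ => (sgn (a l + v) : ℝ) := fun l =>
    measurable_subtype_coe.comp (measurable_sgn.comp (measurable_const.add measurable_id))
  -- Hoeffding's lemma: a variable in `[-1, 1]` has variance proxy `((1 - (-1)) / 2) ^ 2 = 1`, and
  -- `integral_sgn_unif` gives the centring.
  have hsub : ∀ l, HasSubgaussianMGF (fun v : ℝ => (sgn (a l + v) : ℝ) - a l) 1 unif := by
    intro l
    have h := hasSubgaussianMGF_of_mem_Icc (μ := unif) (a := -1) (b := 1) (hmeas l).aemeasurable
      (Eventually.of_forall fun v => by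
        rcases (sgn (a l + v)).eq_one_or with h | h <;> simp [h])
    rw [integral_sgn_unif (ha l)] at h
    convert h using 1
    ext
    norm_num
  set P := Measure.pi fun _ : Fin n => unif with hP
  have hsub1 : ∀ l, HasSubgaussianMGF (fun v : Fin n → ℝ => (sgn (a l + v l) : ℝ) - a l) 1 P := by
    intro l
    have h1 := measurePreserving_eval (fun _ : Fin n => unif) l
    refine HasSubgaussianMGF.of_map (Y := fun v : Fin n → ℝ => v l)
      (X := fun v : ℝ => (sgn (a l + v) : ℝ) - a l) h1.measurable.aemeasurable ?_
    rw [h1.map_eq]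
    exact hsub l
  have hsub2 : ∀ l, HasSubgaussianMGF (fun v : Fin n → ℝ => a l - (sgn (a l + v l) : ℝ)) 1 P := by
    intro l
    convert (hsub1 l).neg using 1
    funext v
    simp
  have hind1 : iIndepFun (fun l (v : Fin n → ℝ) => (sgn (a l + v l) : ℝ) - a l) P :=
    iIndepFun_pi (X := fun l (v : ℝ) => (sgn (a l + v) : ℝ) - a l)
      fun l => ((hmeas l).sub_const _).aemeasurable
  have hind2 : iIndepFun (fun l (v : Fin n → ℝ) => a l - (sgn (a l + v l) : ℝ)) P :=
    iIndepFun_pi (X := fun l (v : ℝ) => a l - (sgn (a l + v) : ℝ))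
      fun l => ((hmeas l).const_sub _).aemeasurable
  have hkt : 0 ≤ k * t := by positivity
  have e1 := HasSubgaussianMGF.measure_sum_ge_le_of_iIndepFun hind1 (c := fun _ => 1) (s := S)
    (fun l _ => hsub1 l) hkt
  have e2 := HasSubgaussianMGF.measure_sum_ge_le_of_iIndepFun hind2 (c := fun _ => 1) (s := S)
    (fun l _ => hsub2 l) hkt
  have hexp : -(k * t) ^ 2 / (2 * ((∑ _i ∈ S, (1 : NNReal) : NNReal) : ℝ)) = -(k * t ^ 2 / 2) := by
    simp only [Finset.sum_const, hS, nsmul_eq_mul, mul_one, NNReal.coe_natCast]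
    field_simp
  rw [hexp] at e1 e2
  have hcover : {v : Fin n → ℝ | t ≤ |1 / (k : ℝ) * ∑ l ∈ S, (a l - (sgn (a l + v l) : ℝ))|} ⊆
      {v | k * t ≤ ∑ l ∈ S, ((sgn (a l + v l) : ℝ) - a l)} ∪
      {v | k * t ≤ ∑ l ∈ S, (a l - (sgn (a l + v l) : ℝ))} := by
    intro v hv
    have hneg : ∑ l ∈ S, ((sgn (a l + v l) : ℝ) - a l) =
        -∑ l ∈ S, (a l - (sgn (a l + v l) : ℝ)) := by
      rw [← Finset.sum_neg_distrib]
      exact Finset.sum_congr rfl fun l _ => by ring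
    simp only [Set.mem_ofPred_eq, Set.mem_union, hneg] at hv ⊢
    rw [abs_mul, abs_of_pos (by positivity : 0 < 1 / (k : ℝ)), one_div, inv_mul_eq_div,
      le_div_iff₀ hk0, le_abs] at hv
    rcases hv with h | h
    · right; linarith
    · left; linarith
  have hreal : P.real {v : Fin n → ℝ | t ≤ |1 / (k : ℝ) * ∑ l ∈ S, (a l - (sgn (a l + v l) : ℝ))|}
      ≤ 2 * Real.exp (-(k * t ^ 2 / 2)) := by
    refine (measureReal_mono hcover).trans ((measureReal_union_le _ _).trans ?_)
    rw [two_mul]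
    exact add_le_add e1 e2
  rw [measureReal_def] at hreal
  exact (ENNReal.le_ofReal_iff_toReal_le (measure_ne_top _ _) (by positivity)).2 hreal

/-- At some data point the kNN average of the noise `g (x_l) - y_l` is at least `t`. -/
def NoiseGe {𝕏 : Type*} [PseudoMetricSpace 𝕏] (k : ℕ) (t : ℝ) (g : 𝕏 → ℝ)
    (s : Equiv.Perm (Fin n)) (D : Fin n → 𝕏 × Label) : Prop :=
  ∃ i, t ≤ |1 / (k : ℝ) * ∑ l ∈ neighbors k s (fun l => (D l).1) (D i).1,
    (g (D l).1 - ((D l).2 : ℝ))|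

variable {𝕏 : Type*} [PseudoMetricSpace 𝕏] [MeasurableSpace 𝕏] [OpensMeasurableSpace 𝕏]
  [SecondCountableTopology 𝕏] {r : ℕ}

theorem measurableSet_noiseGe {α : Type*} [MeasurableSpace α] (k : ℕ) (t : ℝ) {g : 𝕏 → ℝ}
    (hg : Measurable g) {s : α → Equiv.Perm (Fin n)} (hs : Measurable s)
    {D : α → Fin n → 𝕏 × Label} (hD : ∀ l, Measurable fun w => D w l) :
    MeasurableSet {w | NoiseGe k t g (s w) (D w)} := by
  classical
  simp only [NoiseGe, Set.ofPred_exists]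
  refine MeasurableSet.iUnion fun i => measurableSet_le measurable_const ?_
  refine Measurable.abs (Measurable.const_mul ?_ _)
  have : ∀ w, ∑ l ∈ neighbors k (s w) (fun l => (D w l).1) (D w i).1,
      (g (D w l).1 - ((D w l).2 : ℝ)) =
      ∑ l, if l ∈ neighbors k (s w) (fun l => (D w l).1) (D w i).1 then
        (g (D w l).1 - ((D w l).2 : ℝ)) else 0 := by
    intro w
    rw [← Finset.sum_filter]
    congr 1
    ext
    simp
  simp only [this]
  refine Finset.measurable_sum _ fun l _ => Measurable.ite ?_ ?_ measurable_const
  · exact measurableSet_mem_neighbors k hs (fun l => (hD l).fst) (hD i).fst l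
  · exact (hg.comp (hD l).fst).sub (measurable_subtype_coe.comp (hD l).snd)

/-- Once the inputs and `σ` are fixed, the neighbour sets are deterministic, so Hoeffding's bound
applies at each data point; the factor `n` is the union bound. -/
theorem jointLaw_noiseGe_le (P : Measure 𝕏) [IsProbabilityMeasure P]
    (S : Measure (Equiv.Perm (Fin n))) [IsProbabilityMeasure S] {g : 𝕏 → ℝ} (hg : Measurable g)
    (hg1 : ∀ x, g x ∈ Set.Icc (-1 : ℝ) 1) {k : ℕ} (hk : 0 < k) (hkn : k ≤ n) {t : ℝ} (ht : 0 ≤ t)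
    (j : Fin (r + 1)) :
    jointLaw P S r {w | NoiseGe k t g w.1.2.2 (labelled g w.1.1 (w.2 j))} ≤
      ENNReal.ofReal (n * (2 * Real.exp (-(k * t ^ 2 / 2)))) := by
  have hm : MeasurableSet {w : ((Fin n → 𝕏) × (Equiv.Perm (Fin (r + 1)) × Equiv.Perm (Fin n))) ×
      (Fin (r + 1) → Fin n → ℝ) | NoiseGe k t g w.1.2.2 (labelled g w.1.1 (w.2 j))} := by
    refine measurableSet_noiseGe k t hg (by fun_prop) fun l => ?_
    exact (measurable_pi_apply l).comp ((measurable_labelled hg).comp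
      (show Measurable fun w : ((Fin n → 𝕏) × (Equiv.Perm (Fin (r + 1)) × Equiv.Perm (Fin n))) ×
        (Fin (r + 1) → Fin n → ℝ) => (w.1.1, w.2 j) by fun_prop))
  rw [jointLaw, Measure.prod_apply hm]
  refine (lintegral_mono (g := fun _ => ENNReal.ofReal (n * (2 * Real.exp (-(k * t ^ 2 / 2)))))
    fun w => ?_).trans (by simp)
  have hsec : Prod.mk w ⁻¹' {w : ((Fin n → 𝕏) × (Equiv.Perm (Fin (r + 1)) ×
      Equiv.Perm (Fin n))) × (Fin (r + 1) → Fin n → ℝ) |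
      NoiseGe k t g w.1.2.2 (labelled g w.1.1 (w.2 j))} =
      ⋃ i, Function.eval j ⁻¹' {v : Fin n → ℝ | t ≤ |1 / (k : ℝ) *
        ∑ l ∈ neighbors k w.2.2 w.1 (w.1 i), (g (w.1 l) - (sgn (g (w.1 l) + v l) : ℝ))|} := by
    ext c
    simp [NoiseGe, labelled]
  rw [hsec]
  refine (measure_iUnion_le _).trans ?_
  rw [tsum_fintype, ENNReal.ofReal_mul (by positivity), ENNReal.ofReal_natCast]
  refine (Finset.sum_le_card_nsmul _ _ (ENNReal.ofReal (2 * Real.exp (-(k * t ^ 2 / 2))))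
    fun i _ => ?_).trans (by simp)
  rw [(measurePreserving_eval (fun _ : Fin (r + 1) => Measure.pi fun _ : Fin n => unif)
    j).measure_preimage]
  · exact pi_unif_noise_ge_le _ hk (by rw [card_neighbors, min_eq_left hkn]) _
      (fun l => hg1 _) ht
  · refine MeasurableSet.nullMeasurableSet (measurableSet_le measurable_const ?_)
    refine Measurable.abs (Measurable.const_mul (Finset.measurable_sum _ fun l _ => ?_) _)
    exact (measurable_subtype_coe.comp (measurable_sgn.comp
      ((measurable_pi_apply l).const_add _))).const_sub _

theorem summable_mul_exp_neg {k : ℕ → ℕ} {δ : ℝ} (hδ : 0 < δ)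
    (hk : Tendsto (fun n : ℕ => (k n : ℝ) ^ 2 / (n : ℝ) ^ (1 + δ)) atTop atTop) {c : ℝ}
    (hc : 0 < c) : Summable fun n : ℕ => (n : ℝ) * (2 * Real.exp (-(k n * c))) := by
  have hlow : ∀ᶠ n : ℕ in atTop, Real.sqrt n ≤ k n := by
    filter_upwards [hk.eventually_ge_atTop 1, eventually_ge_atTop 1] with n h1 hn
    have hn1 : (1 : ℝ) ≤ n := by exact_mod_cast hn
    have hpos : (0 : ℝ) < (n : ℝ) ^ (1 + δ) := Real.rpow_pos_of_pos (by linarith) _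
    rw [le_div_iff₀ hpos, one_mul] at h1
    have h2 : (n : ℝ) ≤ (n : ℝ) ^ (1 + δ) := by
      conv_lhs => rw [← Real.rpow_one (n : ℝ)]
      exact Real.rpow_le_rpow_of_exponent_le hn1 (by linarith)
    exact Real.sqrt_le_iff.2 ⟨Nat.cast_nonneg _, h2.trans h1⟩
  have hsqrt : Tendsto (fun n : ℕ => Real.sqrt n) atTop atTop :=
    Real.tendsto_sqrt_atTop.comp tendsto_natCast_atTop_atTop
  -- With exponent `-6` in `√n` the exponential is at most `n⁻³` eventually, leaving the summable
  -- `n⁻²` after the factor `n`.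
  have ho := (isLittleO_exp_neg_mul_rpow_atTop hc (-6)).comp_tendsto hsqrt
  refine summable_of_isBigO_nat (g := fun n : ℕ => 1 / (n : ℝ) ^ 2)
    (Real.summable_one_div_nat_pow.2 (by norm_num)) ?_
  refine Asymptotics.IsBigO.of_bound 2 ?_
  filter_upwards [hlow, ho.bound (c := 1) one_pos, eventually_ge_atTop 1] with n h1 h2 hn
  have hn0 : (0 : ℝ) < n := by exact_mod_cast hn
  simp only [Function.comp_apply, one_mul] at h2
  rw [Real.norm_of_nonneg (by positivity), Real.norm_of_nonneg (by positivity)] at h2 ⊢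
  have h3 : Real.sqrt n ^ (-6 : ℝ) = 1 / (n : ℝ) ^ 3 := by
    rw [Real.rpow_neg (Real.sqrt_nonneg _), show (6 : ℝ) = ((6 : ℕ) : ℝ) by norm_num,
      Real.rpow_natCast, show 6 = 2 * 3 by norm_num, pow_mul, Real.sq_sqrt hn0.le, one_div]
  rw [h3] at h2
  have h4 : Real.exp (-(k n * c)) ≤ Real.exp (-c * Real.sqrt n) := by
    apply Real.exp_le_exp.2
    nlinarith
  calc (n : ℝ) * (2 * Real.exp (-(k n * c))) ≤ n * (2 * (1 / (n : ℝ) ^ 3)) := by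
        gcongr; exact h4.trans h2
    _ = 2 * (1 / (n : ℝ) ^ 2) := by field_simp

end Noise

/-! ### Transfer from the observed variables to the symmetric model -/

section Sample

variable {𝕏 Ω : Type*} [MeasurableSpace 𝕏] [MeasurableSpace Ω] {μ : Measure Ω}
  [IsProbabilityMeasure μ] {Q : Measure (𝕏 × Label)} {X : ℕ → Ω → 𝕏} {Y : ℕ → Ω → Label} {r : ℕ}
  {U : (n : ℕ) → Fin n → Fin r → Ω → ℝ} {π : ℕ → Ω → Equiv.Perm (Fin (r + 1))}
  {σ : (n : ℕ) → Ω → Equiv.Perm (Fin n)}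

theorem IsIIDSample.measurePreserving (hs : IsIIDSample μ Q X Y)
    (hi : IsInitialization μ X Y U π σ) (n : ℕ) :
    MeasurePreserving (fun ω => ((fun i : Fin n => (X i ω, Y i ω)),
      ((fun p : Fin n × Fin r => U n p.1 p.2 ω), (π n ω, σ n ω)))) μ
      ((Measure.pi fun _ => Q).prod ((Measure.pi fun _ => unif).prod
        ((uniformOn Set.univ).prod (μ.map (σ n))))) := by
  have hD : Measurable fun ω (i : Fin n) => (X i ω, Y i ω) :=
    measurable_pi_lambda _ fun i => (hs.measurable_X i).prodMk (hs.measurable_Y i)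
  have hU : Measurable fun ω (p : Fin n × Fin r) => U n p.1 p.2 ω :=
    measurable_pi_lambda _ fun p => hi.measurable_U n p.1 p.2
  have hπ := hi.measurable_π n
  have hσ := hi.measurable_σ n
  refine ⟨hD.prodMk (hU.prodMk (hπ.prodMk hσ)), ?_⟩
  have h1 := (indepFun_iff_map_prod_eq_prod_map_map hD.aemeasurable
    (hU.prodMk (hπ.prodMk hσ)).aemeasurable).1 (hi.indep_sample n)
  have h2 := (indepFun_iff_map_prod_eq_prod_map_map hU.aemeasurable
    (hπ.prodMk hσ).aemeasurable).1 (hi.indep_array n)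
  have h3 := (indepFun_iff_map_prod_eq_prod_map_map hπ.aemeasurable hσ.aemeasurable).1
    (hi.indep_perm n)
  have h4 := iIndepFun.map_fun_eq_pi_map (fun p : Fin n × Fin r =>
    (hi.measurable_U n p.1 p.2).aemeasurable) (hi.indep_U n)
  have h5 := iIndepFun.map_fun_eq_pi_map (f := fun (i : Fin n) ω => (X i ω, Y i ω))
    (fun i : Fin n => ((hs.measurable_X i).prodMk (hs.measurable_Y i)).aemeasurable)
    (hs.indep.precomp Fin.val_injective)
  rw [h1, h2, h3, h4, h5, hi.uniform_π n]
  simp only [hs.law]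
  have h6 : ∀ p : Fin n × Fin r, μ.map (U n p.1 p.2) = unif := fun p => hi.uniform_U n p.1 p.2
  simp only [h6]

/-- Events about the observed variables have the probability computed from `jointLaw`. -/
theorem measure_preimage_observed [IsProbabilityMeasure Q] (hs : IsIIDSample μ Q X Y)
    (hi : IsInitialization μ X Y U π σ) {g : 𝕏 → ℝ} (hg : Measurable g)
    (hg1 : ∀ x, g x ∈ Set.Icc (-1 : ℝ) 1) (hQ : IsRegressionFunction Q g) (n : ℕ)
    {E : Set ((Fin n → 𝕏 × Label) × ((Fin n × Fin r → ℝ) ×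
      (Equiv.Perm (Fin (r + 1)) × Equiv.Perm (Fin n))))} (hE : MeasurableSet E) :
    μ ((fun ω => ((fun i : Fin n => (X i ω, Y i ω)),
      ((fun p : Fin n × Fin r => U n p.1 p.2 ω), (π n ω, σ n ω)))) ⁻¹' E) =
      jointLaw Q.fst (μ.map (σ n)) r (observed g ⁻¹' E) := by
  have : IsProbabilityMeasure (μ.map (σ n)) :=
    Measure.isProbabilityMeasure_map (hi.measurable_σ n).aemeasurable
  rw [(hs.measurePreserving hi n).measure_preimage hE.nullMeasurableSet,
    (measurePreserving_observed hg hg1 hQ (μ.map (σ n))).measure_preimage hE.nullMeasurableSet]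

end Sample

/-! ### Strong laws for averages and frequencies -/

section LawOfLargeNumbers

variable {E Ω : Type*} [MeasurableSpace E] [MeasurableSpace Ω] {μ : Measure Ω}
  {P : Measure E} {X : ℕ → Ω → E}

theorem ae_tendsto_avg (hX : ∀ i, Measurable (X i)) (hind : iIndepFun X μ)
    (hlaw : ∀ i, μ.map (X i) = P) {φ : E → ℝ} (hφ : Measurable φ) (hint : Integrable φ P) :
    ∀ᵐ ω ∂μ, Tendsto (fun n : ℕ => 1 / (n : ℝ) * ∑ i : Fin n, φ (X i ω)) atTop
      (𝓝 (∫ x, φ x ∂P)) := by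
  have h := strong_law_ae_real (μ := μ) (fun i ω => φ (X i ω))
    ((integrable_map_measure (hlaw 0 ▸ hφ.aestronglyMeasurable) (hX 0).aemeasurable).1
      (by rwa [hlaw 0]))
    (fun i j hij => (hind.indepFun hij).comp hφ hφ)
    (fun i => (IdentDistrib.mk (hX i).aemeasurable (hX 0).aemeasurable
      (by rw [hlaw, hlaw])).comp hφ)
  filter_upwards [h] with ω hω
  rw [← integral_map (hX 0).aemeasurable (hlaw 0 ▸ hφ.aestronglyMeasurable), hlaw 0] at hω
  refine hω.congr fun n => ?_
  rw [Finset.sum_range, one_div, inv_mul_eq_div]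

open Classical in
theorem ae_tendsto_freq [IsProbabilityMeasure μ] (hX : ∀ i, Measurable (X i)) (hind : iIndepFun X μ)
    (hlaw : ∀ i, μ.map (X i) = P) {A : Set E} (hA : MeasurableSet A) :
    ∀ᵐ ω ∂μ, Tendsto (fun n : ℕ => 1 / (n : ℝ) * (Finset.card {i : Fin n | X i ω ∈ A} : ℝ)) atTop
      (𝓝 (P.real A)) := by
  have : IsProbabilityMeasure P := hlaw 0 ▸ Measure.isProbabilityMeasure_map (hX 0).aemeasurable
  have hm : Measurable (A.indicator (1 : E → ℝ)) := measurable_one.indicator hA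
  have h := ae_tendsto_avg hX hind hlaw hm ((integrable_const (1 : ℝ)).indicator hA)
  filter_upwards [h] with ω hω
  rw [integral_indicator_one hA] at hω
  refine hω.congr fun n => ?_
  rw [Finset.card_filter]
  push_cast
  simp [Set.indicator_apply]

end LawOfLargeNumbers

/-! ### Nearest neighbours are close for most data points -/

section Neighbourhoods

variable {E Ω : Type*} [PseudoMetricSpace E] [SecondCountableTopology E] [MeasurableSpace E]
  [OpensMeasurableSpace E] [MeasurableSpace Ω] {μ : Measure Ω} [IsProbabilityMeasure μ]
  {P : Measure E} {X : ℕ → Ω → E}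

open Classical in
/-- Almost surely, if `k n / n → 0`, the proportion of data points with some of the `k n` nearest
neighbours farther away than `δ` tends to `0`. -/
theorem ae_eventually_card_far_le (hX : ∀ i, Measurable (X i)) (hind : iIndepFun X μ)
    (hlaw : ∀ i, μ.map (X i) = P) {k : ℕ → ℕ}
    (hk : Tendsto (fun n : ℕ => (k n : ℝ) / (n : ℝ)) atTop (𝓝 0)) {δ η : ℝ} (hδ : 0 < δ)
    (hη : 0 < η) :
    ∀ᵐ ω ∂μ, ∀ᶠ n in atTop, ∀ s : Equiv.Perm (Fin n),
      (Finset.card {i : Fin n | ∃ l ∈ neighbors (k n) s (fun l : Fin n => X l ω) (X i ω),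
        δ < dist (X l ω) (X i ω)} : ℝ) ≤ η * n := by
  have hP : IsProbabilityMeasure P := hlaw 0 ▸ Measure.isProbabilityMeasure_map (hX 0).aemeasurable
  have hne : Nonempty E := nonempty_of_isProbabilityMeasure P
  set A : ℕ → Set E := fun j => Metric.ball (TopologicalSpace.denseSeq E j) (δ / 2) with hA
  have hAm : ∀ j, MeasurableSet (A j) := fun j => measurableSet_ball
  have hcov : ⋃ j, A j = Set.univ := by
    refine Set.eq_univ_of_forall fun x => ?_
    obtain ⟨j, hj⟩ := (TopologicalSpace.denseRange_denseSeq E).exists_dist_lt x (half_pos hδ)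
    exact Set.mem_iUnion.2 ⟨j, hj⟩
  -- Finitely many balls of diameter at most `δ` carry all but mass `η`.
  obtain ⟨J, hJ⟩ : ∃ J, 1 - η < P.real (Set.accumulate A J) := by
    have h := tendsto_measure_iUnion_accumulate (μ := P) (f := A)
    rw [hcov, measure_univ] at h
    have h' := (ENNReal.tendsto_toReal (by simp)).comp h
    rw [ENNReal.toReal_one] at h'
    exact (h'.eventually (lt_mem_nhds (by linarith))).exists
  have hBm : MeasurableSet (Set.accumulate A J) :=
    MeasurableSet.biUnion (Set.to_countable _) fun j _ => hAm j
  have hnull : ∀ᵐ ω ∂μ, ∀ i j, P (A j) = 0 → X i ω ∉ A j := by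
    refine ae_all_iff.2 fun i => ae_all_iff.2 fun j => ?_
    by_cases h : P (A j) = 0
    · have : μ (X i ⁻¹' A j) = 0 := by
        rw [← Measure.map_apply (hX i) (hAm j), hlaw i, h]
      filter_upwards [measure_eq_zero_iff_ae_notMem.1 this] with ω hω _ using hω
    · exact Eventually.of_forall fun ω h' => absurd h' h
  have hfreq : ∀ᵐ ω ∂μ, ∀ j, Tendsto (fun n : ℕ =>
      1 / (n : ℝ) * (Finset.card {i : Fin n | X i ω ∈ A j} : ℝ)) atTop (𝓝 (P.real (A j))) :=
    ae_all_iff.2 fun j => ae_tendsto_freq hX hind hlaw (hAm j)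
  filter_upwards [hnull, hfreq, ae_tendsto_freq hX hind hlaw hBm] with ω h1 h2 h3
  -- A ball of positive mass receives a positive fraction of the sample, eventually more than the
  -- vanishing fraction `k n / n`. The balls of mass zero almost surely contain no data point.
  have h4 : ∀ᶠ n : ℕ in atTop, ∀ j ∈ Finset.range (J + 1), P (A j) ≠ 0 →
      k n ≤ Finset.card {i : Fin n | X i ω ∈ A j} := by
    rw [Filter.eventually_all_finset]
    intro j _
    by_cases h : P (A j) = 0
    · exact Eventually.of_forall fun n h' => absurd h h'
    · have hpos : 0 < P.real (A j) := ENNReal.toReal_pos h (measure_ne_top _ _)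
      filter_upwards [(h2 j).eventually (lt_mem_nhds (half_lt_self hpos)),
        hk.eventually (gt_mem_nhds (half_pos hpos)), eventually_ge_atTop 1] with n a b hn _
      have hn0 : (0 : ℝ) < n := by exact_mod_cast hn
      have := b.trans a
      rw [one_div, inv_mul_eq_div, div_lt_div_iff_of_pos_right hn0] at this
      exact_mod_cast this.le
  filter_upwards [h4, h3.eventually (lt_mem_nhds hJ), eventually_ge_atTop 1] with n h5 h6 hn s
  have hn0 : (0 : ℝ) < n := by exact_mod_cast hn
  have hsub : Finset.card {i : Fin n | ∃ l ∈ neighbors (k n) s (fun l : Fin n => X l ω) (X i ω),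
      δ < dist (X l ω) (X i ω)} + Finset.card {i : Fin n | X i ω ∈ Set.accumulate A J} ≤ n := by
    rw [← Finset.card_union_of_disjoint]
    · exact (Finset.card_le_univ _).trans (by simp)
    · rw [Finset.disjoint_left]
      intro i hi hi'
      simp only [Finset.mem_filter, Finset.mem_univ, true_and] at hi hi'
      obtain ⟨l, hl, hd⟩ := hi
      obtain ⟨j, hjJ, hj⟩ := Set.mem_accumulate.1 hi'
      have hPj : P (A j) ≠ 0 := fun h => h1 i j h hj
      have hcard := h5 j (Finset.mem_range.2 (by omega)) hPj
      refine absurd (dist_le_of_mem_neighbors _ (fun l' hl' => ?_) hcard hl) (not_le.2 hd)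
      simp only [Finset.mem_filter, Finset.mem_univ, true_and] at hl'
      have e1 := Metric.mem_ball.1 hl'
      have e2 := Metric.mem_ball.1 hj
      have := dist_triangle_right (X l' ω) (X i ω) (TopologicalSpace.denseSeq E j)
      linarith
  have hsub' : ((Finset.card {i : Fin n | ∃ l ∈ neighbors (k n) s (fun l : Fin n => X l ω) (X i ω),
      δ < dist (X l ω) (X i ω)} : ℕ) : ℝ) + (Finset.card {i : Fin n |
      X i ω ∈ Set.accumulate A J} : ℝ) ≤ n := by exact_mod_cast hsub
  rw [one_div, inv_mul_eq_div, lt_div_iff₀ hn0] at h6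
  linarith

end Neighbourhoods

/-! ### Almost sure vanishing of the bias -/

section BiasLimit

variable {E Ω : Type*} [NormedAddCommGroup E] [NormedSpace ℝ E] [FiniteDimensional ℝ E]
  [MeasurableSpace E] [BorelSpace E] [MeasurableSpace Ω] {μ : Measure Ω} [IsProbabilityMeasure μ]
  {P : Measure E} {X : ℕ → Ω → E}

/-- For i.i.d. points that are almost surely distinct, the empirical squared bias of nearest
neighbour averages of `g` tends to `0` almost surely. -/
theorem ae_tendsto_bias (hX : ∀ i, Measurable (X i)) (hind : iIndepFun X μ)
    (hlaw : ∀ i, μ.map (X i) = P) (hinj : ∀ᵐ ω ∂μ, Function.Injective fun i => X i ω)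
    {g : E → ℝ} (hg : Measurable g) (hg2 : MemLp g 2 P) {k : ℕ → ℕ}
    (hk : Tendsto (fun n : ℕ => (k n : ℝ) / (n : ℝ)) atTop (𝓝 0))
    (hkpos : ∀ᶠ n in atTop, 0 < k n) (η : ℝ) (hη : 0 < η) :
    ∀ᵐ ω ∂μ, ∀ᶠ n in atTop, ∀ s : Equiv.Perm (Fin n), 1 / (n : ℝ) * ∑ i : Fin n,
      (g (X i ω) - 1 / (k n : ℝ) *
        ∑ l ∈ neighbors (k n) s (fun l : Fin n => X l ω) (X i ω), g (X l ω)) ^ 2 ≤ η := by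
  classical
  have hP : IsProbabilityMeasure P := hlaw 0 ▸ Measure.isProbabilityMeasure_map (hX 0).aemeasurable
  have : ProperSpace E := FiniteDimensional.proper_real E
  obtain ⟨γ, hγ⟩ := exists_card_mem_neighbors_le E
  -- The budget `η` is split as `η / 2 + η / 4 + η / 4`: approximation error `3 * (1 + γ) * 2 * ε`,
  -- oscillation `3 * (η / 12)`, and exceptional points at most `12 * M ^ 2 * η'`.
  set ε : ℝ := η / (12 * (1 + γ)) with hε
  have hε0 : 0 < ε := by positivity
  obtain ⟨h, hcs, hhε, hhc, hh2⟩ := hg2.exists_hasCompactSupport_eLpNorm_sub_le (by simp)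
    (ε := ENNReal.ofReal (Real.sqrt ε)) (by simpa using hε0)
  have hd : MemLp (g - h) 2 P := hg2.sub hh2
  have hdint : Integrable (fun x => (g x - h x) ^ 2) P := hd.integrable_sq
  have hdle : ∫ x, (g x - h x) ^ 2 ∂P ≤ ε := by
    rw [hd.eLpNorm_eq_integral_rpow_norm (by simp) (by simp)] at hhε
    have h1 := (ENNReal.ofReal_le_ofReal_iff (Real.sqrt_nonneg _)).1 hhε
    simp only [ENNReal.toReal_ofNat, Real.rpow_ofNat, Pi.sub_apply, Real.norm_eq_abs, sq_abs] at h1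
    rw [show (2 : ℝ)⁻¹ = 1 / 2 by norm_num, ← Real.sqrt_eq_rpow] at h1
    exact (Real.sqrt_le_sqrt_iff hε0.le).1 h1
  obtain ⟨M, hM⟩ := hcs.exists_bound_of_continuous hhc
  have huc := hhc.uniformContinuous_of_tendsto_cocompact hcs.is_zero_at_infty
  obtain ⟨δ, hδ, hδh⟩ := Metric.uniformContinuous_iff.1 huc (Real.sqrt (η / 12)) (by positivity)
  have hM0 : 0 ≤ M := (norm_nonneg _).trans (hM 0)
  -- The summand `1` keeps the denominator positive when `M = 0`.
  set η' : ℝ := η / (48 * (M ^ 2 + 1)) with hη'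
  have hη'0 : 0 < η' := by positivity
  have hdm : Measurable fun x => (g x - h x) ^ 2 := (hg.sub hhc.measurable).pow_const 2
  filter_upwards [hinj, ae_tendsto_avg hX hind hlaw hdm hdint,
    ae_eventually_card_far_le hX hind hlaw hk (half_pos hδ) hη'0] with ω w1 w2 w3
  filter_upwards [w2.eventually (gt_mem_nhds (show ∫ x, (g x - h x) ^ 2 ∂P < 2 * ε by linarith)),
    w3, hkpos, hk.eventually (gt_mem_nhds one_pos), eventually_ge_atTop 1] with n a1 a2 a3 a4 hn s
  have hn0 : (0 : ℝ) < n := by exact_mod_cast hn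
  have hkn : k n ≤ n := by
    rw [div_lt_one hn0] at a4
    exact_mod_cast a4.le
  have key := sum_sq_sub_avg_le a3 (fun i : Fin n =>
      neighbors (k n) s (fun l : Fin n => X l ω) (X i ω))
    (fun i => by rw [card_neighbors, min_eq_left hkn]) γ
    (fun l => hγ n (k n) s (fun l : Fin n => X l ω)
      (w1.comp Fin.val_injective) l)
    (fun i => g (X i ω)) (fun i => h (X i ω)) (M := M) (ε := η / 12) (by positivity)
    (fun i => hM _) _ (fun i hi l hl => by
      have hi' : ¬ ∃ l ∈ neighbors (k n) s (fun l : Fin n => X l ω) (X i ω),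
        δ / 2 < dist (X l ω) (X i ω) := fun h' => hi (Finset.mem_filter.2 ⟨Finset.mem_univ _, h'⟩)
      push Not at hi'
      have e1 := hδh (a := X i ω) (b := X l ω)
        (by rw [dist_comm]; linarith [hi' l hl])
      rw [Real.dist_eq] at e1
      rw [← sq_abs]
      calc |h (X i ω) - h (X l ω)| ^ 2 ≤ Real.sqrt (η / 12) ^ 2 := by gcongr
        _ = η / 12 := Real.sq_sqrt (by positivity))
  have a2' := a2 s
  rw [one_div, inv_mul_eq_div, div_lt_iff₀ hn0] at a1
  rw [one_div, inv_mul_eq_div, div_le_iff₀ hn0]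
  refine key.trans ?_
  have b1 : 3 * (1 + (γ : ℝ)) * ∑ i : Fin n, (g (X i ω) - h (X i ω)) ^ 2 ≤ η / 2 * n := by
    calc _ ≤ 3 * (1 + (γ : ℝ)) * (2 * ε * n) := by gcongr
      _ = η / 2 * n := by rw [hε]; field_simp; ring
  have b2 : M ^ 2 * (Finset.card {i : Fin n | ∃ l ∈ neighbors (k n) s
      (fun l : Fin n => X l ω) (X i ω), δ / 2 < dist (X l ω) (X i ω)} : ℝ) ≤ η / 48 * n := by
    calc _ ≤ (M ^ 2 + 1) * (η' * n) := by gcongr; linarith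
      _ = η / 48 * n := by rw [hη']; field_simp
  linarith

end BiasLimit

/-! ### Absence of atoms and distinct inputs -/

section Distinct

variable {𝕏 Ω : Type*} [MetricSpace 𝕏] [SecondCountableTopology 𝕏] [MeasurableSpace 𝕏]
  [MeasurableSpace Ω] {μ : Measure Ω} [IsProbabilityMeasure μ]
  {P : Measure 𝕏} [IsProbabilityMeasure P] {X : ℕ → Ω → 𝕏}

/-- At an atom, three independent points would coincide with positive probability, and both
distances would be `0`. -/
theorem measure_singleton_eq_zero_of_dist_ne
    (htie : ∀ᵐ p ∂(P.prod (P.prod P)), dist p.1 p.2.1 ≠ dist p.1 p.2.2) (a : 𝕏) : P {a} = 0 := by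
  have h : P.prod (P.prod P) ({a} ×ˢ ({a} ×ˢ {a})) = 0 := by
    refine measure_mono_null ?_ (ae_iff.1 htie)
    rintro ⟨x, y, z⟩ ⟨hx, hy, hz⟩
    simp only [Set.mem_singleton_iff] at hx hy hz
    simp [hy, hz]
  rw [Measure.prod_prod, Measure.prod_prod] at h
  simpa using h

theorem ae_injective [BorelSpace 𝕏] (hX : ∀ i, Measurable (X i)) (hind : iIndepFun X μ)
    (hlaw : ∀ i, μ.map (X i) = P) (hatom : ∀ a, P {a} = 0) :
    ∀ᵐ ω ∂μ, Function.Injective fun i => X i ω := by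
  have hdiag : P.prod P {p | p.1 = p.2} = 0 := by
    have hm : MeasurableSet {p : 𝕏 × 𝕏 | p.1 = p.2} :=
      (isClosed_eq continuous_fst continuous_snd).measurableSet
    rw [Measure.prod_apply hm]
    refine (lintegral_congr fun x => ?_).trans lintegral_zero
    convert hatom x using 2
    ext y
    simp [eq_comm]
  have h : ∀ i j, i ≠ j → ∀ᵐ ω ∂μ, X i ω ≠ X j ω := by
    intro i j hij
    have h1 := (indepFun_iff_map_prod_eq_prod_map_map (hX i).aemeasurable
      (hX j).aemeasurable).1 (hind.indepFun hij)
    rw [hlaw, hlaw] at h1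
    rw [← h1] at hdiag
    exact ae_of_ae_map ((hX i).prodMk (hX j)).aemeasurable (measure_eq_zero_iff_ae_notMem.1 hdiag)
  have h' : ∀ᵐ ω ∂μ, ∀ i j, i ≠ j → X i ω ≠ X j ω :=
    ae_all_iff.2 fun i => ae_all_iff.2 fun j => by
      by_cases hij : i = j
      · exact Eventually.of_forall fun _ h => absurd hij h
      · exact (h i j hij).mono fun _ h _ => h
  filter_upwards [h'] with ω hω i j hij
  by_contra hne
  exact hω i j hne hij

end Distinct

/-! ### From the ambient space to a subset -/

section Subtype

variable {E Ω : Type*} [NormedAddCommGroup E] [NormedSpace ℝ E] [FiniteDimensional ℝ E]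
  [MeasurableSpace E] [BorelSpace E] [MeasurableSpace Ω] {μ : Measure Ω} [IsProbabilityMeasure μ]
  {𝕏 : Set E} {P : Measure 𝕏} [IsProbabilityMeasure P] {X : ℕ → Ω → 𝕏}

/-- The σ-algebra of `𝕏` is induced from `E`, so `g` extends to a measurable function on `E` even if
`𝕏` is not measurable. The extension needs no bound off `𝕏`, only square integrability for the
pushed-forward law. -/
theorem ae_tendsto_bias_subtype (hX : ∀ i, Measurable (X i)) (hind : iIndepFun X μ)
    (hlaw : ∀ i, μ.map (X i) = P) (hinj : ∀ᵐ ω ∂μ, Function.Injective fun i => X i ω)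
    {g : 𝕏 → ℝ} (hg : Measurable g) (hg1 : ∀ x, g x ∈ Set.Icc (-1 : ℝ) 1) {k : ℕ → ℕ}
    (hk : Tendsto (fun n : ℕ => (k n : ℝ) / (n : ℝ)) atTop (𝓝 0))
    (hkpos : ∀ᶠ n in atTop, 0 < k n) {η : ℝ} (hη : 0 < η) :
    ∀ᵐ ω ∂μ, ∀ᶠ n in atTop, ∀ s : Equiv.Perm (Fin n), 1 / (n : ℝ) * ∑ i : Fin n,
      (g (X i ω) - 1 / (k n : ℝ) *
        ∑ l ∈ neighbors (k n) s (fun l : Fin n => X l ω) (X i ω), g (X l ω)) ^ 2 ≤ η := by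
  obtain ⟨g', hg', rfl⟩ := Measurable.exists_eq_measurable_comp (f := (Subtype.val : 𝕏 → E)) hg
  have hval : Measurable (Subtype.val : 𝕏 → E) := measurable_subtype_coe
  have hL : MemLp g' 2 (P.map Subtype.val) := by
    rw [memLp_map_measure_iff hg'.aestronglyMeasurable hval.aemeasurable]
    exact MemLp.of_bound hg.aestronglyMeasurable 1
      (Eventually.of_forall fun x => abs_le.2 (hg1 x))
  exact ae_tendsto_bias (P := P.map Subtype.val) (X := fun i ω => (X i ω : E))
    (fun i => hval.comp (hX i)) (hind.comp (fun _ => Subtype.val) fun _ => hval)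
    (fun i => by rw [← hlaw i, Measure.map_map hval (hX i)]; rfl)
    (hinj.mono fun ω hω => Subtype.val_injective.comp hω) hg' hL hk hkpos η hη

end Subtype

/-! ### Upper and lower bounds for reference variables -/

section RefVar

variable {𝕏 : Type*} [PseudoMetricSpace 𝕏] {n : ℕ}

theorem refVar_le {k : ℕ} {s : Equiv.Perm (Fin n)} {g : 𝕏 → ℝ} {D : Fin n → 𝕏 × Label}
    {t η : ℝ} (hnoise : ¬ NoiseGe k t g s D)
    (hbias : 1 / (n : ℝ) * ∑ i, (g (D i).1 - 1 / (k : ℝ) *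
      ∑ l ∈ neighbors k s (fun l => (D l).1) (D i).1, g (D l).1) ^ 2 ≤ η) :
    refVar k s g D ≤ 2 * η + 2 * t ^ 2 := by
  have hpt : ∀ i, (g (D i).1 - knnEstimate k s D (D i).1) ^ 2 ≤
      2 * (g (D i).1 - 1 / (k : ℝ) *
        ∑ l ∈ neighbors k s (fun l => (D l).1) (D i).1, g (D l).1) ^ 2 + 2 * t ^ 2 := by
    intro i
    simp only [NoiseGe, not_exists, not_le] at hnoise
    have h1 := hnoise i
    set b := g (D i).1 - 1 / (k : ℝ) * ∑ l ∈ neighbors k s (fun l => (D l).1) (D i).1, g (D l).1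
      with hb
    set e := 1 / (k : ℝ) * ∑ l ∈ neighbors k s (fun l => (D l).1) (D i).1,
      (g (D l).1 - ((D l).2 : ℝ)) with he
    -- Bias `b` plus averaged noise `e`, combined below through `(b + e) ^ 2 ≤ 2 * b ^ 2 + 2 * e ^
    -- 2`.
    have h2 : g (D i).1 - knnEstimate k s D (D i).1 = b + e := by
      rw [hb, he, knnEstimate, Finset.sum_sub_distrib]
      ring
    have h3 : e ^ 2 ≤ t ^ 2 := sq_le_sq.2 (h1.le.trans (le_abs_self t))
    rw [h2]
    nlinarith [sq_nonneg (b - e)]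
  rw [refVar]
  calc _ ≤ 1 / (n : ℝ) * ∑ i, (2 * (g (D i).1 - 1 / (k : ℝ) *
        ∑ l ∈ neighbors k s (fun l => (D l).1) (D i).1, g (D l).1) ^ 2 + 2 * t ^ 2) := by
        gcongr with i _
        exact hpt i
    _ = 2 * (1 / (n : ℝ) * ∑ i, (g (D i).1 - 1 / (k : ℝ) *
        ∑ l ∈ neighbors k s (fun l => (D l).1) (D i).1, g (D l).1) ^ 2)
        + 1 / (n : ℝ) * n * (2 * t ^ 2) := by
        rw [Finset.sum_add_distrib, ← Finset.mul_sum, Finset.sum_const, Finset.card_univ,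
          Fintype.card_fin, nsmul_eq_mul]
        ring
    _ ≤ 2 * η + 1 * (2 * t ^ 2) := by
        gcongr
        rw [one_div]
        exact inv_mul_le_one
    _ = _ := by ring

/-- Both candidates are compared with the same estimate `c`, and `(f - g) ^ 2 ≤ 2 * (f - c) ^ 2 + 2
* (g - c) ^ 2`. One dataset thus cannot fit two separated candidates. -/
theorem le_refVar (k : ℕ) (s : Equiv.Perm (Fin n)) (f g : 𝕏 → ℝ) (D : Fin n → 𝕏 × Label) :
    1 / 2 * (1 / (n : ℝ) * ∑ i, (f (D i).1 - g (D i).1) ^ 2) ≤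
      refVar k s f D + refVar k s g D := by
  rw [refVar, refVar, ← mul_add, ← Finset.sum_add_distrib, mul_left_comm, Finset.mul_sum]
  gcongr with i _
  nlinarith [sq_nonneg ((f (D i).1 - knnEstimate k s D (D i).1) +
    (g (D i).1 - knnEstimate k s D (D i).1))]

theorem rank_eq_of_forall_lt {r : ℕ} {p : Equiv.Perm (Fin (r + 1))} {z₀ : ℝ} {z : Fin r → ℝ}
    (h : ∀ j, z j < z₀) : rank p z₀ z = r + 1 := by
  classical
  unfold rank
  rw [Finset.filter_true_of_mem fun j _ => Or.inl (h j)]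
  simp [add_comm]

end RefVar

/-! ### Borel–Cantelli for the noise -/

section BorelCantelli

variable {𝕏 Ω : Type*} [PseudoMetricSpace 𝕏] [MeasurableSpace Ω] {μ : Measure Ω}
  {σ : (n : ℕ) → Ω → Equiv.Perm (Fin n)} {k : ℕ → ℕ}

theorem ae_eventually_not_noiseGe {g : 𝕏 → ℝ} {D : (n : ℕ) → Ω → Fin n → 𝕏 × Label} {t : ℝ}
    (ht : 0 < t)
    (hk : Tendsto (fun n : ℕ => (k n : ℝ) / (n : ℝ)) atTop (𝓝 0))
    {δ : ℝ} (hδ : 0 < δ)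
    (hkδ : Tendsto (fun n : ℕ => (k n : ℝ) ^ 2 / (n : ℝ) ^ (1 + δ)) atTop atTop)
    (hkpos : ∀ᶠ n in atTop, 0 < k n)
    (hD : ∀ n, 0 < k n → k n ≤ n → μ {ω | NoiseGe (k n) t g (σ n ω) (D n ω)} ≤
      ENNReal.ofReal (n * (2 * Real.exp (-(k n * t ^ 2 / 2))))) :
    ∀ᵐ ω ∂μ, ∀ᶠ n in atTop, ¬ NoiseGe (k n) t g (σ n ω) (D n ω) := by
  have hsum := summable_mul_exp_neg hδ hkδ (c := t ^ 2 / 2) (by positivity)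
  -- The tail bound is available only for `0 < k n ≤ n`; inserting this condition into the event
  -- discards finitely many `n`.
  have hfin : ∑' n, μ {ω | (0 < k n ∧ k n ≤ n) ∧ NoiseGe (k n) t g (σ n ω) (D n ω)} ≠ ∞ := by
    refine ne_top_of_le_ne_top hsum.tsum_ofReal_ne_top (ENNReal.tsum_le_tsum fun n => ?_)
    by_cases h : 0 < k n ∧ k n ≤ n
    · simp only [h, true_and]
      refine (hD n h.1 h.2).trans (le_of_eq ?_)
      rw [mul_div_assoc]
    · simp [h]
  filter_upwards [ae_eventually_notMem hfin] with ω hω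
  filter_upwards [hω, hkpos, hk.eventually (gt_mem_nhds one_pos), eventually_ge_atTop 1]
    with n h1 h2 h3 hn h4
  have hn0 : (0 : ℝ) < n := by exact_mod_cast hn
  rw [div_lt_one hn0] at h3
  exact h1 ⟨⟨h2, by exact_mod_cast h3.le⟩, h4⟩

end BorelCantelli

/-! ### Noise bounds and coverage for the observed data -/

section Observed


variable {𝕏 Ω : Type*} [PseudoMetricSpace 𝕏] [MeasurableSpace 𝕏] [OpensMeasurableSpace 𝕏]
  [SecondCountableTopology 𝕏] [MeasurableSpace Ω] {μ : Measure Ω}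
  [IsProbabilityMeasure μ] {Q : Measure (𝕏 × Label)} [IsProbabilityMeasure Q]
  {X : ℕ → Ω → 𝕏} {Y : ℕ → Ω → Label} {r : ℕ}
  {U : (n : ℕ) → Fin n → Fin r → Ω → ℝ} {π : ℕ → Ω → Equiv.Perm (Fin (r + 1))}
  {σ : (n : ℕ) → Ω → Equiv.Perm (Fin n)}

theorem measure_noiseGe_sample_le (hs : IsIIDSample μ Q X Y) (hi : IsInitialization μ X Y U π σ)
    {g : 𝕏 → ℝ} (hg : Measurable g) (hg1 : ∀ x, g x ∈ Set.Icc (-1 : ℝ) 1)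
    (hQ : IsRegressionFunction Q g) {t : ℝ} (ht : 0 ≤ t) {n k : ℕ} (hk : 0 < k) (hkn : k ≤ n) :
    μ {ω | NoiseGe k t g (σ n ω) (fun i : Fin n => (X i ω, Y i ω))} ≤
      ENNReal.ofReal (n * (2 * Real.exp (-(k * t ^ 2 / 2)))) := by
  have : IsProbabilityMeasure (μ.map (σ n)) :=
    Measure.isProbabilityMeasure_map (hi.measurable_σ n).aemeasurable
  have hE : MeasurableSet {o : (Fin n → 𝕏 × Label) × ((Fin n × Fin r → ℝ) ×
      (Equiv.Perm (Fin (r + 1)) × Equiv.Perm (Fin n))) | NoiseGe k t g o.2.2.2 o.1} :=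
    measurableSet_noiseGe k t hg (by fun_prop) (fun l => by fun_prop)
  have h := measure_preimage_observed hs hi hg hg1 hQ n hE
  refine (le_of_eq h).trans ?_
  exact jointLaw_noiseGe_le Q.fst (μ.map (σ n)) hg hg1 hk hkn ht (Fin.last r)

theorem measurable_altSample {𝕏 : Type*} [MeasurableSpace 𝕏] {n r : ℕ} {g : 𝕏 → ℝ}
    (hg : Measurable g) (j : Fin r) :
    Measurable fun o : (Fin n → 𝕏 × Label) × ((Fin n × Fin r → ℝ) ×
      (Equiv.Perm (Fin (r + 1)) × Equiv.Perm (Fin n))) =>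
      altSample g o.1 (fun i j => o.2.1 (i, j)) j := by
  refine measurable_pi_lambda _ fun i => ?_
  have h1 : Measurable fun o : (Fin n → 𝕏 × Label) × ((Fin n × Fin r → ℝ) ×
      (Equiv.Perm (Fin (r + 1)) × Equiv.Perm (Fin n))) => (o.1 i).1 := by fun_prop
  have h2 : Measurable fun o : (Fin n → 𝕏 × Label) × ((Fin n × Fin r → ℝ) ×
      (Equiv.Perm (Fin (r + 1)) × Equiv.Perm (Fin n))) => o.2.1 (i, j) := by fun_prop
  exact h1.prodMk (measurable_sgn.comp ((hg.comp h1).add h2))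

/-- The true regression function `h` serves only to describe the joint law. An alternative sample
keeps the inputs and takes its labels from `g`, so its noise is centred even when `g` is wrong. -/
theorem measure_noiseGe_altSample_le (hs : IsIIDSample μ Q X Y)
    (hi : IsInitialization μ X Y U π σ) {h : 𝕏 → ℝ} (hh : Measurable h)
    (hh1 : ∀ x, h x ∈ Set.Icc (-1 : ℝ) 1) (hQ : IsRegressionFunction Q h)
    {g : 𝕏 → ℝ} (hg : Measurable g) (hg1 : ∀ x, g x ∈ Set.Icc (-1 : ℝ) 1)
    {t : ℝ} (ht : 0 ≤ t) {n k : ℕ} (hk : 0 < k) (hkn : k ≤ n) (j : Fin r) :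
    μ {ω | NoiseGe k t g (σ n ω)
        (altSample g (fun i : Fin n => (X i ω, Y i ω)) (fun i j => U n i j ω) j)} ≤
      ENNReal.ofReal (n * (2 * Real.exp (-(k * t ^ 2 / 2)))) := by
  have : IsProbabilityMeasure (μ.map (σ n)) :=
    Measure.isProbabilityMeasure_map (hi.measurable_σ n).aemeasurable
  have hE : MeasurableSet {o : (Fin n → 𝕏 × Label) × ((Fin n × Fin r → ℝ) ×
      (Equiv.Perm (Fin (r + 1)) × Equiv.Perm (Fin n))) |
      NoiseGe k t g o.2.2.2 (altSample g o.1 (fun i j => o.2.1 (i, j)) j)} :=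
    measurableSet_noiseGe k t hg (by fun_prop)
      (fun l => (measurable_pi_apply l).comp (measurable_altSample hg j))
  have h' := measure_preimage_observed hs hi hh hh1 hQ n hE
  refine (le_of_eq h').trans ?_
  exact jointLaw_noiseGe_le Q.fst (μ.map (σ n)) hg hg1 hk hkn ht j.castSucc

/-- Exact coverage: the true parameter belongs to the region with probability `q / (r + 1)`. -/
theorem measure_mem_randomRegion {Θ : Type*} (hs : IsIIDSample μ Q X Y)
    (hi : IsInitialization μ X Y U π σ) {f : Θ → 𝕏 → ℝ} {θ : Θ} (hf : Measurable (f θ))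
    (hf1 : ∀ x, f θ x ∈ Set.Icc (-1 : ℝ) 1) (hQ : IsRegressionFunction Q (f θ))
    {q : ℕ} (hq : q ≤ r + 1) (k : ℕ → ℕ) (n : ℕ) :
    μ {ω | θ ∈ randomRegion f q k X Y U π σ n ω} = (q : ℝ≥0∞) / ((r + 1 : ℕ) : ℝ≥0∞) := by
  have : IsProbabilityMeasure (μ.map (σ n)) :=
    Measure.isProbabilityMeasure_map (hi.measurable_σ n).aemeasurable
  set z : (Fin n → 𝕏 × Label) × ((Fin n × Fin r → ℝ) ×
      (Equiv.Perm (Fin (r + 1)) × Equiv.Perm (Fin n))) → Fin (r + 1) → ℝ := fun o =>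
    Fin.snoc (α := fun _ => ℝ) (fun j => refVar (k n) o.2.2.2 (f θ)
      (altSample (f θ) o.1 (fun i j => o.2.1 (i, j)) j)) (refVar (k n) o.2.2.2 (f θ) o.1) with hz
  have hzm : ∀ j, Measurable fun o => z o j := by
    intro j
    refine Fin.lastCases ?_ (fun j => ?_) j
    · simp only [hz, Fin.snoc_last]
      exact measurable_refVar _ hf (by fun_prop) (fun l => by fun_prop)
    · simp only [hz, Fin.snoc_castSucc]
      exact measurable_refVar _ hf (by fun_prop)
        (fun l => (measurable_pi_apply l).comp (measurable_altSample hf j))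
  have hE : MeasurableSet {o | predCount o.2.2.1 (z o) (Fin.last r) < q} :=
    measurable_predCount (by fun_prop) hzm _ measurableSet_Iio
  have h1 := measure_preimage_observed hs hi hf hf1 hQ n hE
  set Z : ((Fin n → 𝕏) × Equiv.Perm (Fin n)) × (Fin n → ℝ) → ℝ := fun w =>
    refVar (k n) w.1.2 (f θ) (labelled (f θ) w.1.1 w.2) with hZ
  have hZm : Measurable Z := measurable_refVar _ hf (by fun_prop) fun l =>
    (measurable_pi_apply l).comp ((measurable_labelled hf).comp
      (show Measurable fun w : ((Fin n → 𝕏) × Equiv.Perm (Fin n)) × (Fin n → ℝ) =>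
        (w.1.1, w.2) by fun_prop))
  rw [← jointLaw_predCount_lt Q.fst (μ.map (σ n)) Z hZm hq]
  have h2 : {ω | θ ∈ randomRegion f q k X Y U π σ n ω} =
      (fun ω => ((fun i : Fin n => (X i ω, Y i ω)),
      ((fun p : Fin n × Fin r => U n p.1 p.2 ω), (π n ω, σ n ω)))) ⁻¹'
        {o | predCount o.2.2.1 (z o) (Fin.last r) < q} := by
    ext ω
    have hr := rank_eq_predCount (π n ω) (z ((fun i : Fin n => (X i ω, Y i ω)),
      ((fun p : Fin n × Fin r => U n p.1 p.2 ω), (π n ω, σ n ω))))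
    simp only [hz, Fin.snoc_last, Fin.snoc_castSucc] at hr
    simp only [randomRegion, region, Set.mem_ofPred_eq, Set.mem_preimage, hr, hz]
    omega
  rw [h2, h1]
  congr 1
  ext w
  -- In the symmetric model the original dataset loses its special role: each reference variable is
  -- `Z` applied to its own column.
  have : z (observed (f θ) w) = fun j => Z ((w.1.1, w.1.2.2), w.2 j) := by
    funext j
    refine Fin.lastCases ?_ (fun j => ?_) j
    · simp only [hz, Fin.snoc_last]; rfl
    · simp only [hz, Fin.snoc_castSucc]; rfl
  simp only [Set.mem_preimage, Set.mem_ofPred_eq, this]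
  rfl

end Observed

/-! ### Strong pointwise consistency -/

section Consistency

variable {E Ω : Type*} [NormedAddCommGroup E] [NormedSpace ℝ E] [FiniteDimensional ℝ E]
  [MeasurableSpace E] [BorelSpace E] [MeasurableSpace Ω] {μ : Measure Ω} [IsProbabilityMeasure μ]
  {𝕏 : Set E} {Q : Measure (𝕏 × Label)} [IsProbabilityMeasure Q]
  {X : ℕ → Ω → 𝕏} {Y : ℕ → Ω → Label} {r : ℕ}
  {U : (n : ℕ) → Fin n → Fin r → Ω → ℝ} {π : ℕ → Ω → Equiv.Perm (Fin (r + 1))}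
  {σ : (n : ℕ) → Ω → Equiv.Perm (Fin n)} {k : ℕ → ℕ}

/-- Strong pointwise consistency: a wrong parameter almost surely belongs to at most finitely many
of the regions. -/
theorem measure_limsup_mem_randomRegion_eq_zero {Θ : Type*} (hs : IsIIDSample μ Q X Y)
    (hi : IsInitialization μ X Y U π σ) {f : Θ → 𝕏 → ℝ} {θ' θ : Θ} (hf' : Measurable (f θ'))
    (hf1' : ∀ x, f θ' x ∈ Set.Icc (-1 : ℝ) 1) (hQ : IsRegressionFunction Q (f θ'))
    (hf : Measurable (f θ)) (hf1 : ∀ x, f θ x ∈ Set.Icc (-1 : ℝ) 1)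
    (hne : sqDistQ Q (f θ) (f θ') ≠ 0) {q : ℕ} (hq : q < r + 1)
    (hk : Tendsto (fun n : ℕ => (k n : ℝ) / (n : ℝ)) atTop (𝓝 0)) {δ : ℝ} (hδ : 0 < δ)
    (hkδ : Tendsto (fun n : ℕ => (k n : ℝ) ^ 2 / (n : ℝ) ^ (1 + δ)) atTop atTop)
    (htie : ∀ᵐ p ∂(Q.fst.prod (Q.fst.prod Q.fst)), dist p.1 p.2.1 ≠ dist p.1 p.2.2) :
    μ (⋂ n : ℕ, ⋃ l ≥ n, {ω | θ ∈ randomRegion f q k X Y U π σ l ω}) = 0 := by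
  have hkpos : ∀ᶠ n in atTop, 0 < k n := by
    filter_upwards [hkδ.eventually_gt_atTop 0] with n hn
    rcases Nat.eq_zero_or_pos (k n) with h | h
    · simp [h] at hn
    · exact h
  have hlaw : ∀ i, μ.map (X i) = Q.fst := fun i => by
    rw [← hs.law i, Measure.fst, Measure.map_map measurable_fst
      ((hs.measurable_X i).prodMk (hs.measurable_Y i))]
    rfl
  have hind : iIndepFun X μ := hs.indep.comp (fun _ => Prod.fst) fun _ => measurable_fst
  have hdist := ae_injective hs.measurable_X hind hlaw (measure_singleton_eq_zero_of_dist_ne htie)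
  set a := sqDistQ Q (f θ) (f θ') with ha
  have ha0 : 0 < a := lt_of_le_of_ne (integral_nonneg fun _ => sq_nonneg _) hne.symm
  -- With bias and `t ^ 2` both at most `a / 64`, the small reference variables are at most `a /
  -- 16`. The one of the original sample at `θ` exceeds `a / 4 - a / 16 = 3 * a / 16`.
  set t : ℝ := Real.sqrt (a / 64) with ht
  have ht0 : 0 < t := Real.sqrt_pos.2 (by positivity)
  have ht2 : t ^ 2 = a / 64 := Real.sq_sqrt (by positivity)
  have hη : 0 < a / 64 := by positivity
  have hdm : Measurable fun x => (f θ x - f θ' x) ^ 2 := (hf.sub hf').pow_const 2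
  have hdint : Integrable (fun x => (f θ x - f θ' x) ^ 2) Q.fst :=
    Integrable.of_bound hdm.aestronglyMeasurable 4 (Eventually.of_forall fun x => by
      have h1 := hf1 x
      have h2 := hf1' x
      rw [Real.norm_of_nonneg (sq_nonneg _)]
      nlinarith [h1.1, h1.2, h2.1, h2.2])
  have hbias := ae_tendsto_bias_subtype hs.measurable_X hind hlaw hdist hf hf1 hk hkpos hη
  have hbias' := ae_tendsto_bias_subtype hs.measurable_X hind hlaw hdist hf' hf1' hk hkpos hη
  have hnoise' := ae_eventually_not_noiseGe (μ := μ) (σ := σ) (g := f θ')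
    (D := fun n ω i => (X i ω, Y i ω)) ht0 hk hδ hkδ hkpos fun n h0 hn =>
      measure_noiseGe_sample_le hs hi hf' hf1' hQ ht0.le h0 hn
  have hnoise : ∀ᵐ ω ∂μ, ∀ j : Fin r, ∀ᶠ n in atTop, ¬ NoiseGe (k n) t (f θ) (σ n ω)
      (altSample (f θ) (fun i : Fin n => (X i ω, Y i ω)) (fun i j => U n i j ω) j) :=
    ae_all_iff.2 fun j => ae_eventually_not_noiseGe (μ := μ) (σ := σ) (g := f θ)
      (D := fun n ω => altSample (f θ) (fun i : Fin n => (X i ω, Y i ω)) (fun i j => U n i j ω) j)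
      ht0 hk hδ hkδ hkpos fun n h0 hn =>
        measure_noiseGe_altSample_le hs hi hf' hf1' hQ hf hf1 ht0.le h0 hn j
  have hev : ∀ᵐ ω ∂μ, ∀ᶠ n in atTop, θ ∉ randomRegion f q k X Y U π σ n ω := by
    filter_upwards [hbias, hbias', hnoise', hnoise,
      ae_tendsto_avg hs.measurable_X hind hlaw hdm hdint] with ω h1 h2 h3 h4 h5
    filter_upwards [h1, h2, h3, eventually_all.2 h4,
      h5.eventually (lt_mem_nhds (half_lt_self ha0))] with n b1 b2 b3 b4 b5
    set D : Fin n → 𝕏 × Label := fun i => (X i ω, Y i ω) with hD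
    have c1 : refVar (k n) (σ n ω) (f θ') D ≤ 2 * (a / 64) + 2 * t ^ 2 :=
      refVar_le b3 (b2 (σ n ω))
    have c2 : ∀ j, refVar (k n) (σ n ω) (f θ) (altSample (f θ) D (fun i j => U n i j ω) j) ≤
        2 * (a / 64) + 2 * t ^ 2 := fun j => refVar_le (b4 j) (b1 (σ n ω))
    have c3 := le_refVar (k n) (σ n ω) (f θ) (f θ') D
    have c4 : a / 2 < 1 / (n : ℝ) * ∑ i, (f θ (D i).1 - f θ' (D i).1) ^ 2 := b5
    simp only [randomRegion, region, Set.mem_ofPred_eq, not_le]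
    rw [rank_eq_of_forall_lt fun j => ?_]
    · exact hq
    · have := c2 j
      rw [ht2] at this c1
      linarith
  have hsub : (⋂ n : ℕ, ⋃ l ≥ n, {ω | θ ∈ randomRegion f q k X Y U π σ l ω}) ⊆
      {ω | ¬ ∀ᶠ n in atTop, θ ∉ randomRegion f q k X Y U π σ n ω} := by
    intro ω hω hω'
    obtain ⟨N, hN⟩ := eventually_atTop.1 hω'
    obtain ⟨l, hl, hmem⟩ := Set.mem_iUnion₂.1 (Set.mem_iInter.1 hω N)
    exact hN l hl hmem
  exact measure_mono_null hsub (ae_iff.1 hev)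

end Consistency

end KnnRegion

/-! ### The main theorem -/

theorem theorem4 {Ω : Type*} [MeasurableSpace Ω] (μ : Measure Ω) [IsProbabilityMeasure μ]
    -- the input space is a subset of `ℝᵈ`
    {d : ℕ} (𝕏 : Set (EuclideanSpace ℝ (Fin d)))
    (Q : Measure (𝕏 × KnnRegion.Label)) [IsProbabilityMeasure Q]
    (X : ℕ → Ω → 𝕏) (Y : ℕ → Ω → KnnRegion.Label)
    (hsample : KnnRegion.IsIIDSample μ Q X Y)
    -- the candidate regression functions; the true one is among them, with parameter `θstar`
    {Θ : Type*} (f : Θ → 𝕏 → ℝ) (hf_meas : ∀ θ, Measurable (f θ))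
    (hf_range : ∀ θ x, f θ x ∈ Set.Icc (-1 : ℝ) 1)
    (θstar : Θ) (hstar : KnnRegion.IsRegressionFunction Q (f θstar))
    (hinj : ∀ θ₁ θ₂, θ₁ ≠ θ₂ → KnnRegion.sqDistQ Q (f θ₁) (f θ₂) ≠ 0)
    -- the algorithm: `m = r + 1` datasets, neighbour numbers `k n`, generated variables
    (r : ℕ) (k : ℕ → ℕ)
    (U : (n : ℕ) → Fin n → Fin r → Ω → ℝ) (π : ℕ → Ω → Equiv.Perm (Fin (r + 1)))
    (σ : (n : ℕ) → Ω → Equiv.Perm (Fin n))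
    (hinit : KnnRegion.IsInitialization μ X Y U π σ)
    (q : ℕ) (hq : q ≤ r + 1) :
    -- exact coverage
    (∀ n, μ {ω | θstar ∈ KnnRegion.randomRegion f q k X Y U π σ n ω} =
      (q : ℝ≥0∞) / ((r + 1 : ℕ) : ℝ≥0∞)) ∧
    -- strong pointwise consistency
    (q < r + 1 →
      Tendsto (fun n : ℕ => (k n : ℝ) / (n : ℝ)) atTop (𝓝 0) →
      (∃ δ : ℝ, 0 < δ ∧
        Tendsto (fun n : ℕ => (k n : ℝ) ^ 2 / (n : ℝ) ^ (1 + δ)) atTop atTop) →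
      (∀ᵐ p ∂(Q.fst.prod (Q.fst.prod Q.fst)), dist p.1 p.2.1 ≠ dist p.1 p.2.2) →
      ∀ θ, θ ≠ θstar →
        μ (⋂ n : ℕ, ⋃ l ≥ n, {ω | θ ∈ KnnRegion.randomRegion f q k X Y U π σ l ω}) = 0) := by
  refine ⟨fun n => KnnRegion.measure_mem_randomRegion hsample hinit (hf_meas θstar)
    (hf_range θstar) hstar hq k n, ?_⟩
  rintro hqr hk ⟨δ, hδ, hkδ⟩ htie θ hθ
  exact KnnRegion.measure_limsup_mem_randomRegion_eq_zero hsample hinit (hf_meas θstar)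
    (hf_range θstar) hstar (hf_meas θ) (hf_range θ) (hinj θ θstar hθ) hqr hk hδ hkδ htie
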